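/- Let $\mathcal A$ and $\mathcal B$ be abelian categories, and suppose that $\mathcal B$ has enough projectives. Let $f^*\colon\mathcal A\to\mathcal B$ be a faithful functor with a left adjoint $f_!\colon\mathcal B\to\mathcal A$, and let $\nu\colon\mathcal A\to\mathcal A$ be a Nakayama functor relative to $f_!\dashv f^*$. This means that $\nu$ has a right adjoint $\nu^-$, that $f_*:=\nu\circ f_!$ is right adjoint to $f^*$, and that the unit of $\nu\dashv\nu^-$ induces an isomorphism $f_!\xrightarrow{\ \cong\ }\nu^-\circ\nu\circ f_!$. All functors are additive. Put $P=f_!\circ f^*$. The functors $f_!f^*$, $\nu f_!f^*=f_*f^*$ and $\nu^-f_*f^*\cong f_!f^*$ are exact, every object of $\mathcal A$ is a quotient of an object in the image of $f_!$ (through the counit of $f_!\dashv f^*$), and every object of $\mathcal A$ embeds into an object in the image of $f_*$ (through the unit of $f^*\dashv f_*$). Hence the left derived functors $L_i\nu$ and the right derived functors $R^i\nu^-$ exist: $L_i\nu(X)$ is the $i$-th homology of $\nu$ applied to a resolution of $X$ by objects in the image of $f_!$, and $R^i\nu^-(X)$ is the $i$-th cohomology of $\nu^-$ applied to a coresolution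 of $X$ by objects in the image of $f_*$. Call $P$ Iwanaga–Gorenstein if there is an integer $n\ge 0$ such that $L_i\nu=0$ and $R^i\nu^-=0$ for all $i>n$. For an abelian category $\mathcal C$ with enough projectives, let $\mathcal{GP}(\mathcal C)$ denote the full subcategory of Gorenstein projective objects, i.e. those isomorphic to $Z_0(Q_\bullet)=\operatorname{Ker}(Q_0\to Q_{-1})$ for an acyclic complex $Q_\bullet$ of projective objects such that the complex $\mathcal C(Q_\bullet,Q)$ is acyclic for every projective object $Q$. Note that $\mathcal A$ has enough projectives, since $\mathcal B$ does. An object of $\mathcal A$ is $P$-projective if it is a direct summand of $P(Y)$ for some $Y\in\mathcal A$. Let $\mathcal{GP}_P(\mathcal A)$ denote the full subcategory of Gorenstein $P$-projective objects, i.e. those isomorphic to $Z_0(A_\bullet)$ for an acyclic complex $A_\bullet$ of $P$-projective objects such that $\nu(A_\bullet)$ is also acyclic. Finally put $$\mathcal{GP}(\mathcal{GP}_P(\mathcal A)):=\{X\in\mathcal A\mid X\in\mathcal{GP}_P(\mathcal A)\text{ and } f^*\nu(X)\in\mathcal{GP}(\mathcal B)\}.$$ If $P$ is Iwanaga–Gorenstein,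 then $$\mathcal{GP}(\mathcal{GP}_P(\mathcal A))=\mathcal{GP}(\mathcal A).$$ -/

import Mathlib

open CategoryTheory CategoryTheory.Limits

universe v u v' u'

noncomputable section

namespace GorensteinLift

section Gorenstein

variable {A : Type u} [Category.{v} A] [Abelian A]

/-- A complex `⋯ ⟶ Q₁ ⟶ Q₀ ⟶ Q₋₁ ⟶ ⋯` is totally acyclic if it is an acyclic complex of
projective objects and `Hom(Q_•, Q)` is acyclic for every projective object `Q`: each morphism
`g : Q_i ⟶ Q` with `d_{i+1} ≫ g = 0` factors through `d_i : Q_i ⟶ Q_{i-1}`. -/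
structure IsTotallyAcyclic (K : ChainComplex A ℤ) : Prop where
  projective : ∀ i : ℤ, Projective (K.X i)
  acyclic : K.Acyclic
  hom_acyclic : ∀ Q : A, Projective Q → ∀ (i : ℤ) (g : K.X i ⟶ Q),
    K.d (i + 1) i ≫ g = 0 → ∃ h : K.X (i - 1) ⟶ Q, K.d i (i - 1) ≫ h = g

variable (A) in
/-- The Gorenstein projective objects: those isomorphic to the object of cycles `Z₀ = Ker d₀` of a
totally acyclic complex. -/
def gorensteinProjective : ObjectProperty A := fun X =>
  ∃ K : ChainComplex A ℤ, IsTotallyAcyclic K ∧ Nonempty (X ≅ K.cycles 0)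

end Gorenstein

section Derived

variable {A : Type u} [Category.{v} A] [Abelian A] {D : Type u'} [Category.{v'} D]
variable {E : Type*} [Category* E] [Abelian E]

/-- For an adjunction `L ⊣ R` with `L : D ⥤ A` and `R` faithful, every object `X` of `A` is a
functorial quotient of an object in the image of `L`, through the counit `L R X ⟶ X`. -/
def counitLeftResolution {L : D ⥤ A} {R : A ⥤ D} (adj : L ⊣ R) [R.Faithful] :
    Abelian.LeftResolution (𝟭 A) where
  F := R ⋙ L
  π := adj.counit
  epi_π_app X := inferInstanceAs (Epi (adj.counit.app X))

/-- The functor that sends `X` to its canonical resolution by objects in the image of `L`: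
`⋯ ⟶ L R X₂ ⟶ L R X₁ ⟶ L R X₀ (⟶ X ⟶ 0)`, where `X₀ = X`, where `X₁` is the kernel of the counit
`L R X ⟶ X`, and where `X_{i+1}` is the kernel of the differential `L R X_i ⟶ L R X_{i-1}` for
`i ≥ 1`; the differentials are the composites `L R X_i ⟶ X_i ⟶ L R X_{i-1}`. -/
def adaptedResolution {L : D ⥤ A} {R : A ⥤ D} (adj : L ⊣ R) [R.Faithful] :
    A ⥤ ChainComplex A ℕ :=
  (counitLeftResolution adj).chainComplexFunctor

/-- The `i`-th left derived functor of a right exact functor `G`, computed by resolutions by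
objects in the image of a functor `L` that is adapted to `G`: `L` has a faithful right adjoint `R`
(so that each object is a quotient of one in the image of `L`), and `L R` and `G L R` are exact.
Neither enough projectives nor enough injectives are needed. -/
def adaptedLeftDerived {L : D ⥤ A} {R : A ⥤ D} (adj : L ⊣ R) [R.Faithful]
    (G : A ⥤ E) [G.Additive] (i : ℕ) : A ⥤ E :=
  adaptedResolution adj ⋙ G.mapHomologicalComplex (ComplexShape.down ℕ) ⋙
    HomologicalComplex.homologyFunctor E (ComplexShape.down ℕ) i

/-- The dual construction: the `i`-th right derived functor of `G`, computed by coresolutions by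
objects in the image of a functor `R` adapted to `G`, where `L ⊣ R` and `L` is faithful. -/
def adaptedRightDerived {L : A ⥤ D} {R : D ⥤ A} (adj : L ⊣ R) [L.Faithful]
    (G : A ⥤ E) [G.Additive] (i : ℕ) : A ⥤ E :=
  (adaptedLeftDerived adj.op G.op i).unop

end Derived

section Nakayama

variable {A : Type u} [Category.{v} A] [Abelian A] {D : Type u'} [Category.{v'} D]

/-- A Nakayama functor `ν` relative to an adjunction `f_! ⊣ f^*`, together with the choice of a
right adjoint `ν⁻`. -/
structure NakayamaFunctor {fShriek : D ⥤ A} {fUpper : A ⥤ D} (adj : fShriek ⊣ fUpper) where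
  /-- the functor `ν` -/
  nu : A ⥤ A
  /-- its right adjoint `ν⁻` -/
  nuMinus : A ⥤ A
  additive_nu : nu.Additive
  additive_nuMinus : nuMinus.Additive
  /-- the adjunction `ν ⊣ ν⁻` -/
  adjNu : nu ⊣ nuMinus
  /-- `f_* = ν ∘ f_!` is right adjoint to `f^*` -/
  adjStar : fUpper ⊣ fShriek ⋙ nu
  /-- the unit `f_! ⟶ ν⁻ ∘ ν ∘ f_!` is an isomorphism -/
  isIso_unit : ∀ d : D, IsIso (adjNu.unit.app (fShriek.obj d))

namespace NakayamaFunctor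

attribute [instance] additive_nu additive_nuMinus

variable {fShriek : D ⥤ A} {fUpper : A ⥤ D} {adj : fShriek ⊣ fUpper} (N : NakayamaFunctor adj)

/-- The left derived functor `L_i ν`; the functor `f_!` is adapted to `ν`, because `f_! f^*` and
`ν f_! f^* = f_* f^*` are exact (each of `f_!`, `f^*`, `f_*` has a left and a right adjoint). -/
def leftDerivedNu [fUpper.Faithful] (i : ℕ) : A ⥤ A :=
  adaptedLeftDerived adj N.nu i

/-- The right derived functor `R^i ν⁻`; the functor `f_*` is adapted to `ν⁻`, because `f_* f^*`
and `ν⁻ f_* f^* ≅ f_! f^*` are exact. -/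
def rightDerivedNuMinus [fUpper.Faithful] (i : ℕ) : A ⥤ A :=
  adaptedRightDerived N.adjStar N.nuMinus i

/-- `P = f_! ∘ f^*` is Iwanaga–Gorenstein if there is `n ≥ 0` such that `L_i ν = 0` and
`R^i ν⁻ = 0` for all `i > n`. -/
def IsIwanagaGorenstein [fUpper.Faithful] : Prop :=
  ∃ n : ℕ, ∀ i : ℕ, n < i →
    (∀ X : A, IsZero ((N.leftDerivedNu i).obj X)) ∧
      (∀ X : A, IsZero ((N.rightDerivedNuMinus i).obj X))

end NakayamaFunctor

/-- The `P`-projective objects for `P = f_! ∘ f^*`: the direct summands of objects `P(Y)`. -/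
def relProjective (fShriek : D ⥤ A) (fUpper : A ⥤ D) : ObjectProperty A := fun X =>
  ∃ Y : A, Nonempty (Retract X (fShriek.obj (fUpper.obj Y)))

namespace NakayamaFunctor

variable {fShriek : D ⥤ A} {fUpper : A ⥤ D} {adj : fShriek ⊣ fUpper} (N : NakayamaFunctor adj)

/-- The Gorenstein `P`-projective objects: those isomorphic to `Z₀` of an acyclic complex of
`P`-projective objects that stays acyclic under `ν`. -/
def relGorensteinProjective : ObjectProperty A := fun X =>
  ∃ K : ChainComplex A ℤ, (∀ i : ℤ, relProjective fShriek fUpper (K.X i)) ∧ K.Acyclic ∧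
    ((N.nu.mapHomologicalComplex (ComplexShape.down ℤ)).obj K).Acyclic ∧
    Nonempty (X ≅ K.cycles 0)

end NakayamaFunctor

end Nakayama

section Lift

variable {A : Type u} [Category.{v} A] [Abelian A] {B : Type u'} [Category.{v'} B] [Abelian B]

/-- `GP(GP_P(A)) = (f^* ∘ ν)⁻¹(GP(B)) ∩ GP_P(A)`. -/
def NakayamaFunctor.liftedGorensteinProjective {fShriek : B ⥤ A} {fUpper : A ⥤ B}
    {adj : fShriek ⊣ fUpper} (N : NakayamaFunctor adj) : ObjectProperty A := fun X =>
  gorensteinProjective B (fUpper.obj (N.nu.obj X)) ∧ N.relGorensteinProjective X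

end Lift

end GorensteinLift

end

/-! Call `X` ν-acyclic if `L_i ν X = 0` for all `i > 0`. Both sides of the equality are compared
with the class `C` of ν-acyclic `X` with `f^* ν X` in `GP(B)`. What links `A` to `B` is that `f^* ν
⊣ f_!` (`adjShriek`), because `ν⁻ ν f_! ≅ f_!`. Hence `f_!`, `f^*` and `P` are exact, `f_!` and `f^*
ν` preserve projectives, and every projective of `A` is a summand of some `f_! Q` with `Q`
projective.

Objects of `GP_P(A)` and of `GP(A)` are ν-acyclic: they have infinite coresolutions by
P-projectives, so dimension shifting moves their `L_i ν` into the range where it vanishes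
(`isAcyclicFor_of_coresolution`). Thus `f^* ν` sends the sequences of cycles of a totally acyclic
complex to short exact sequences, and the adjunction transports extension of maps into projectives.
This gives `GP(A) ⊆ GP(GP_P(A))`.

Conversely, `C` has the `Ext` vanishing of Gorenstein projectives (`extVanishes_of_isAcyclic`),
again by adjunction. The main point is that `C` has cosyzygies in `C`
(`exists_cosyzygy_of_isAcyclic`). An embedding of `f^* ν X` in a projective `Q` has an adjunct `X ⟶
f_! Q`, which is mono because the unit of `f^* ν ⊣ f_!` is mono at ν-acyclic objects; this uses the
vanishing of `R^i ν⁻` (`IsAcyclic.mono_unit`). That the cokernel stays in `C` follows from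
`gorensteinProjective_X₃`. -/

set_option linter.unusedSectionVars false

namespace CategoryTheory.Abelian.LeftResolution

/-! ### Syzygies of a functorial left resolution -/

section Syzygy

lemma _root_.CategoryTheory.ShortComplex.Exact.exists_lift_up_to_refinements {C : Type*}
    [Category* C] [Abelian C] {X Y Z : C} {f : X ⟶ Y} {g : Y ⟶ Z} {w : f ≫ g = 0}
    (h : (ShortComplex.mk f g w).Exact) {W : C} (y : W ⟶ Y) (hy : y ≫ g = 0) :
    ∃ (W' : C) (p : W' ⟶ W) (_ : Epi p) (x : W' ⟶ X), p ≫ y = x ≫ f :=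
  h.exact_up_to_refinements y hy

variable {A : Type*} [Category* A] [Abelian A] (Λ : LeftResolution (𝟭 A))

lemma _root_.HomologicalComplex.exists_shortExact_cycles (K : ChainComplex A ℤ) (hK : K.Acyclic) {i j : ℤ} (h : j + 1 = i) :
    ∃ w : K.iCycles i ≫ K.toCycles i j = 0,
      (ShortComplex.mk (K.iCycles i) (K.toCycles i j) w).ShortExact := by
  have w : K.iCycles i ≫ K.toCycles i j = 0 := by
    rw [← cancel_mono (K.iCycles j)]; simp
  have hl := K.cyclesIsKernel i j ((ComplexShape.down ℤ).next_eq' h)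
  have : Epi (K.toCycles i j) := by
    have := hK j
    rw [HomologicalComplex.exactAt_iff_isZero_homology] at this
    have h1 := K.homologyIsCokernel i j ((ComplexShape.down ℤ).prev_eq' h)
    exact Preadditive.epi_of_isZero_cokernel' _ h1 this
  refine ⟨w, .mk' ?_ inferInstance this⟩
  rw [ShortComplex.exact_iff_exact_up_to_refinements]
  intro W x hx
  have hx' : x ≫ K.d i j = 0 := by
    rw [← K.toCycles_i i j, ← Category.assoc]
    exact (congrArg (· ≫ _) hx).trans zero_comp
  exact ⟨W, 𝟙 _, inferInstance, K.liftCycles x j ((ComplexShape.down ℤ).next_eq' h) hx', by simp⟩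

/-- The natural epimorphism `F X ⟶ X` of a left resolution of the identity. -/
noncomputable abbrev proj (X : A) : Λ.F.obj X ⟶ X := Λ.π.app X

instance (X : A) : Epi (Λ.proj X) := Λ.epi_π_app X

lemma map_comp_proj {X Y : A} (f : X ⟶ Y) :
    Λ.F.map f ≫ Λ.proj Y = Λ.proj X ≫ f := Λ.π.naturality f

/-- The syzygy functor attached to a functorial left resolution. -/
noncomputable def syzygy : A ⥤ A where
  obj X := kernel (Λ.proj X)
  map f := kernel.map _ _ (Λ.F.map f) f (Λ.map_comp_proj f).symm
  map_id X := by rw [← cancel_mono (kernel.ι _)]; simp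
  map_comp f g := by rw [← cancel_mono (kernel.ι _)]; simp

/-- The inclusion of the syzygy of `X` in `F X`. -/
noncomputable def incl (X : A) : Λ.syzygy.obj X ⟶ Λ.F.obj X := kernel.ι _

instance (X : A) : Mono (Λ.incl X) := inferInstanceAs (Mono (kernel.ι _))

lemma map_comp_incl {X Y : A} (f : X ⟶ Y) :
    Λ.syzygy.map f ≫ Λ.incl Y = Λ.incl X ≫ Λ.F.map f := kernel.lift_ι _ _ _

lemma incl_comp_proj (X : A) : Λ.incl X ≫ Λ.proj X = 0 := kernel.condition _

/-- A morphism to `F X` that is killed by `F X ⟶ X` factors through the syzygy. -/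
noncomputable def lift {W X : A} (k : W ⟶ Λ.F.obj X) (h : k ≫ Λ.proj X = 0) :
    W ⟶ Λ.syzygy.obj X := kernel.lift _ k h

@[simp]
lemma lift_comp_incl {W X : A} (k : W ⟶ Λ.F.obj X) (h : k ≫ Λ.proj X = 0) :
    Λ.lift k h ≫ Λ.incl X = k := kernel.lift_ι _ _ _

/-- The short exact sequence `0 ⟶ Ω X ⟶ F X ⟶ X ⟶ 0`. -/
noncomputable abbrev syzygySeq (X : A) : ShortComplex A :=
  ShortComplex.mk (Λ.incl X) (Λ.proj X) (Λ.incl_comp_proj X)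

lemma syzygySeq_shortExact (X : A) : (Λ.syzygySeq X).ShortExact :=
  .mk' (ShortComplex.exact_of_f_is_kernel _ (kernelIsKernel _)) inferInstance inferInstance

/-- The iterated syzygies of an object. -/
noncomputable def syz : ℕ → A → A
  | 0, X => X
  | n + 1, X => Λ.syzygy.obj (syz n X)

variable [Λ.F.Additive]

instance : Λ.syzygy.PreservesZeroMorphisms where
  map_zero X Y := by
    rw [← cancel_mono (Λ.incl Y), map_comp_incl, Functor.map_zero, comp_zero, zero_comp]

variable [PreservesFiniteLimits Λ.F] [PreservesFiniteColimits Λ.F]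

/-- Snake lemma for the rows `F S` and `S`: the kernels form a short exact sequence because `F` is
exact and `F S.X₁ ⟶ S.X₁` is epi. -/
lemma syzygy_map_shortExact {S : ShortComplex A} (hS : S.ShortExact) :
    (S.map Λ.syzygy).ShortExact := by
  have hF := hS.map_of_exact Λ.F
  have := hF.mono_f
  have : Mono (Λ.F.map S.f) := hF.mono_f
  have : Epi (Λ.F.map S.g) := hF.epi_g
  have := hS.mono_f
  have := hS.epi_g
  refine .mk' ?_ ?_ ?_
  · rw [ShortComplex.exact_iff_exact_up_to_refinements]
    intro W y hy
    change W ⟶ Λ.syzygy.obj S.X₂ at y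
    change y ≫ Λ.syzygy.map S.g = 0 at hy
    have h1 : (y ≫ Λ.incl S.X₂) ≫ Λ.F.map S.g = 0 := by
      rw [Category.assoc, ← map_comp_incl, reassoc_of% hy, zero_comp]
    obtain ⟨l, h2⟩ : ∃ l : W ⟶ Λ.F.obj S.X₁, l ≫ Λ.F.map S.f = y ≫ Λ.incl S.X₂ :=
      ⟨_, hF.exact.lift_f _ h1⟩
    have h3 : l ≫ Λ.proj S.X₁ = 0 := by
      rw [← cancel_mono S.f, Category.assoc, ← map_comp_proj, reassoc_of% h2, incl_comp_proj,
        comp_zero, zero_comp]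
    refine ⟨W, 𝟙 _, inferInstance, Λ.lift _ h3, ?_⟩
    change 𝟙 W ≫ y = Λ.lift _ h3 ≫ Λ.syzygy.map S.f
    rw [← cancel_mono (Λ.incl _), Category.id_comp, Category.assoc, map_comp_incl,
      ← Category.assoc, lift_comp_incl, h2]
  · have : Mono (Λ.syzygy.map S.f ≫ Λ.incl S.X₂) := by
      rw [map_comp_incl]; exact mono_comp (Λ.incl S.X₁) (Λ.F.map S.f)
    exact mono_of_mono (Λ.syzygy.map S.f) (Λ.incl S.X₂)
  · change Epi (Λ.syzygy.map S.g)
    rw [epi_iff_surjective_up_to_refinements]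
    intro W z
    obtain ⟨W1, p1, _, t, ht⟩ := surjective_up_to_refinements_of_epi (Λ.F.map S.g) (z ≫ Λ.incl _)
    have h1 : (t ≫ Λ.proj _) ≫ S.g = 0 := by
      rw [Category.assoc, ← map_comp_proj, ← reassoc_of% ht, incl_comp_proj, comp_zero, comp_zero]
    have h2 := hS.exact.lift_f _ h1
    obtain ⟨W2, p2, _, x, hx⟩ :=
      surjective_up_to_refinements_of_epi (Λ.proj S.X₁) (hS.exact.lift _ h1)
    have h3 : (p2 ≫ t - x ≫ Λ.F.map S.f) ≫ Λ.proj _ = 0 := by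
      rw [Preadditive.sub_comp, Category.assoc, Category.assoc, map_comp_proj, ← reassoc_of% hx,
        h2, sub_self]
    refine ⟨W2, p2 ≫ p1, inferInstance, Λ.lift _ h3, ?_⟩
    rw [← cancel_mono (Λ.incl _), Category.assoc, Category.assoc, Category.assoc, map_comp_incl,
      ← Category.assoc (Λ.lift _ _), lift_comp_incl, Preadditive.sub_comp, Category.assoc,
      Category.assoc, ← Functor.map_comp, S.zero, Functor.map_zero, comp_zero, sub_zero, ← ht]

end Syzygy

/-! ### Acyclic objects and dimension shifting for a right exact functor -/

section Acyclic

variable {A : Type*} [Category* A] [Abelian A] {E : Type*} [Category* E] [Abelian E]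
  (Λ : LeftResolution (𝟭 A)) (G : A ⥤ E)

/-- The first derived functor of `G`, computed with `Λ`, vanishes at `X`. -/
def FirstVanishes (X : A) : Prop := Mono (G.map (Λ.incl X))

/-- All higher derived functors of `G`, computed with `Λ`, vanish at `X`. -/
def IsAcyclicFor (X : A) : Prop := ∀ n, Λ.FirstVanishes G (Λ.syz n X)

variable {Λ G}

/-- The syzygy inclusion is then a split mono, which every functor preserves. -/
lemma firstVanishes_of_isSplitEpi {X : A} (h : IsSplitEpi (Λ.proj X)) : Λ.FirstVanishes G X := by
  obtain ⟨⟨s⟩⟩ := h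
  have h1 : (𝟙 _ - Λ.proj X ≫ s.section_) ≫ Λ.proj X = 0 := by simp
  have : IsSplitMono (Λ.incl X) := ⟨⟨Λ.lift _ h1, by
    rw [← cancel_mono (Λ.incl X), Category.assoc, lift_comp_incl, Preadditive.comp_sub,
      ← Category.assoc (Λ.incl X), incl_comp_proj]
    simp⟩⟩
  exact inferInstanceAs (Mono (G.map (Λ.incl X)))

lemma isSplitEpi_of_retract {X Y : A} (r : Retract X Y) (h : IsSplitEpi (Λ.proj Y)) :
    IsSplitEpi (Λ.proj X) := by
  obtain ⟨⟨s⟩⟩ := h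
  exact ⟨⟨r.i ≫ s.section_ ≫ Λ.F.map r.r, by
    rw [Category.assoc, Category.assoc, map_comp_proj, SplitEpi.id_assoc, r.retract]⟩⟩

/-- The syzygy becomes a direct summand of `F X`, where the projection splits by `hΛ`. -/
lemma isSplitEpi_syzygy (hΛ : ∀ X, IsSplitEpi (Λ.proj (Λ.F.obj X))) {X : A}
    (h : IsSplitEpi (Λ.proj X)) : IsSplitEpi (Λ.proj (Λ.syzygy.obj X)) := by
  obtain ⟨⟨s⟩⟩ := h
  have h1 : (𝟙 _ - Λ.proj X ≫ s.section_) ≫ Λ.proj X = 0 := by simp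
  refine isSplitEpi_of_retract ⟨Λ.incl X, Λ.lift _ h1, ?_⟩ (hΛ X)
  rw [← cancel_mono (Λ.incl X), Category.assoc, lift_comp_incl, Preadditive.comp_sub,
    ← Category.assoc (Λ.incl X), incl_comp_proj]
  simp

lemma isAcyclicFor_of_isSplitEpi (hΛ : ∀ X, IsSplitEpi (Λ.proj (Λ.F.obj X))) {X : A}
    (h : IsSplitEpi (Λ.proj X)) : Λ.IsAcyclicFor G X := by
  intro n
  apply firstVanishes_of_isSplitEpi
  induction n with
  | zero => exact h
  | succ n ih => exact isSplitEpi_syzygy hΛ ih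

lemma IsAcyclicFor.of_iso {X Y : A} (h : Λ.IsAcyclicFor G Y) (e : X ≅ Y) :
    Λ.IsAcyclicFor G X := by
  intro n
  obtain ⟨e⟩ : Nonempty (Λ.syz n X ≅ Λ.syz n Y) := by
    induction n with
    | zero => exact ⟨e⟩
    | succ n ih => exact ⟨Λ.syzygy.mapIso ih.some⟩
  have : Mono (G.map (Λ.incl (Λ.syz n Y))) := h n
  have : Mono (G.map (Λ.incl (Λ.syz n X)) ≫ G.map (Λ.F.map e.hom)) := by
    rw [← Functor.map_comp, ← map_comp_incl, Functor.map_comp]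
    exact mono_comp _ _
  exact mono_of_mono _ (G.map (Λ.F.map e.hom))

variable [G.Additive] [PreservesFiniteColimits G] [Λ.F.Additive] [PreservesFiniteLimits Λ.F]
  [PreservesFiniteColimits Λ.F] [PreservesFiniteLimits (Λ.F ⋙ G)]

lemma map_exact_and_epi (G : A ⥤ E) [G.Additive] [PreservesFiniteColimits G]
    {S : ShortComplex A} (hS : S.ShortExact) : (S.map G).Exact ∧ Epi (G.map S.g) :=
  (Functor.preservesFiniteColimits_iff_forall_exact_map_and_epi G).1 inferInstance S hS

/-- This is the exactness of `L₁G X₃ ⟶ G X₁ ⟶ G X₂`. An element of `G X₁` killed in `G X₂` lifts to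
`G F X₁`; its image in `G F X₂` comes from `G Ω X₂`, and there from `G Ω X₁` since `G Ω X₃ ⟶ G F X₃`
is mono. As `G F` preserves monos, the lift itself comes from `G Ω X₁`. -/
lemma mono_map_of_firstVanishes {S : ShortComplex A} (hS : S.ShortExact)
    (h : Λ.FirstVanishes G S.X₃) : Mono (G.map S.f) := by
  have hFG := hS.map_of_exact (Λ.F ⋙ G)
  have : Mono (G.map (Λ.F.map S.f)) := hFG.mono_f
  have hΩ := map_exact_and_epi G (Λ.syzygy_map_shortExact hS)
  have h1 := map_exact_and_epi G (Λ.syzygySeq_shortExact S.X₁)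
  have h2 := map_exact_and_epi G (Λ.syzygySeq_shortExact S.X₂)
  have : Epi (G.map (Λ.proj S.X₁)) := h1.2
  have : Mono (G.map (Λ.incl S.X₃)) := h
  refine Preadditive.mono_of_cancel_zero _ fun {W} x hx => ?_
  obtain ⟨W1, p1, _, t, ht⟩ := surjective_up_to_refinements_of_epi (G.map (Λ.proj S.X₁)) x
  have e1 : (t ≫ G.map (Λ.F.map S.f)) ≫ G.map (Λ.proj S.X₂) = 0 := by
    rw [Category.assoc, ← Functor.map_comp, map_comp_proj, Functor.map_comp, ← reassoc_of% ht, hx,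
      comp_zero]
  obtain ⟨W2, p2, _, y, hy⟩ := ShortComplex.Exact.exists_lift_up_to_refinements (f := G.map (Λ.incl S.X₂)) h2.1 _ e1
  have e2 : y ≫ G.map (Λ.syzygy.map S.g) = 0 := by
    rw [← cancel_mono (G.map (Λ.incl S.X₃)), Category.assoc, ← Functor.map_comp, map_comp_incl,
      Functor.map_comp, ← reassoc_of% hy, ← Functor.map_comp, ← Functor.map_comp, S.zero]
    simp
  obtain ⟨W3, p3, _, w, hw⟩ := 
    ShortComplex.Exact.exists_lift_up_to_refinements (f := G.map (Λ.syzygy.map S.f)) hΩ.1 _ e2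
  have e3 : p3 ≫ p2 ≫ t = w ≫ G.map (Λ.incl S.X₁) := by
    rw [← cancel_mono (G.map (Λ.F.map S.f)), Category.assoc, Category.assoc, Category.assoc, hy,
      reassoc_of% hw, ← Functor.map_comp, ← Functor.map_comp, map_comp_incl]
  have : Epi (p3 ≫ p2 ≫ p1) := inferInstance
  rw [← cancel_epi (p3 ≫ p2 ≫ p1), Category.assoc, Category.assoc, ht, reassoc_of% e3,
    ← Functor.map_comp, incl_comp_proj, Functor.map_zero, comp_zero, comp_zero]

/-- Exactness of `L₁G X₂ ⟶ L₁G X₃ ⟶ G X₁ ⟶ G X₂` at the two middle terms. -/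
lemma firstVanishes_X₃ {S : ShortComplex A} (hS : S.ShortExact)
    (h : Λ.FirstVanishes G S.X₂) [Mono (G.map S.f)] : Λ.FirstVanishes G S.X₃ := by
  have hFG := hS.map_of_exact (Λ.F ⋙ G)
  have hΩ := map_exact_and_epi G (Λ.syzygy_map_shortExact hS)
  have h1 := map_exact_and_epi G (Λ.syzygySeq_shortExact S.X₁)
  have : Epi (G.map (Λ.syzygy.map S.g)) := hΩ.2
  have : Mono (G.map (Λ.incl S.X₂)) := h
  refine Preadditive.mono_of_cancel_zero _ fun {W} z hz => ?_
  obtain ⟨W1, p1, _, y, hy⟩ := surjective_up_to_refinements_of_epi (G.map (Λ.syzygy.map S.g)) z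
  have e1 : (y ≫ G.map (Λ.incl _)) ≫ G.map (Λ.F.map S.g) = 0 := by
    rw [Category.assoc, ← Functor.map_comp, ← map_comp_incl, Functor.map_comp, ← reassoc_of% hy,
      hz, comp_zero]
  obtain ⟨W2, p2, _, x, hx⟩ := 
    ShortComplex.Exact.exists_lift_up_to_refinements (f := G.map (Λ.F.map S.f)) hFG.exact _ e1
  have e2 : x ≫ G.map (Λ.proj S.X₁) = 0 := by
    rw [← cancel_mono (G.map S.f), Category.assoc, ← Functor.map_comp, ← map_comp_proj,
      Functor.map_comp, ← reassoc_of% hx, ← Functor.map_comp, incl_comp_proj]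
    simp
  obtain ⟨W3, p3, _, w, hw⟩ := 
    ShortComplex.Exact.exists_lift_up_to_refinements (f := G.map (Λ.incl S.X₁)) h1.1 _ e2
  have e3 : p3 ≫ p2 ≫ y = w ≫ G.map (Λ.syzygy.map S.f) := by
    rw [← cancel_mono (G.map (Λ.incl _)), Category.assoc, Category.assoc, Category.assoc, hx,
      reassoc_of% hw, ← Functor.map_comp, ← Functor.map_comp, map_comp_incl]
  have : Epi (p3 ≫ p2 ≫ p1) := inferInstance
  rw [← cancel_epi (p3 ≫ p2 ≫ p1), Category.assoc, Category.assoc, hy, reassoc_of% e3,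
    ← Functor.map_comp, ← Functor.map_comp, S.zero]
  simp

/-- Exactness of `L₂G X₃ ⟶ L₁G X₁ ⟶ L₁G X₂`, with `L₂G X₃` read as `L₁G (Ω X₃)`. -/
lemma firstVanishes_X₁ {S : ShortComplex A} (hS : S.ShortExact)
    (h2 : Λ.FirstVanishes G S.X₂) (h3 : Λ.FirstVanishes G (Λ.syzygy.obj S.X₃)) :
    Λ.FirstVanishes G S.X₁ := by
  have : Mono (G.map (Λ.syzygy.map S.f)) :=
    mono_map_of_firstVanishes (Λ.syzygy_map_shortExact hS) h3
  have : Mono (G.map (Λ.incl S.X₂)) := h2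
  have : Mono (G.map (Λ.incl S.X₁) ≫ G.map (Λ.F.map S.f)) := by
    rw [← Functor.map_comp, ← map_comp_incl, Functor.map_comp]
    exact mono_comp _ _
  exact mono_of_mono _ (G.map (Λ.F.map S.f))

/-- Exactness of `L₂G X₂ ⟶ L₂G X₃ ⟶ L₁G X₁`, with `L₂G` read as `L₁G` of the syzygy. -/
lemma firstVanishes_syzygy_X₃ {S : ShortComplex A} (hS : S.ShortExact)
    (h1 : Λ.FirstVanishes G S.X₁) (h2 : Λ.FirstVanishes G (Λ.syzygy.obj S.X₂)) :
    Λ.FirstVanishes G (Λ.syzygy.obj S.X₃) := by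
  have : Mono (G.map (Λ.F.map S.f)) := (hS.map_of_exact (Λ.F ⋙ G)).mono_f
  have : Mono (G.map (Λ.incl S.X₁)) := h1
  have : Mono (G.map (Λ.syzygy.map S.f) ≫ G.map (Λ.incl S.X₂)) := by
    rw [← Functor.map_comp, map_comp_incl, Functor.map_comp]
    exact mono_comp _ _
  have : Mono (G.map (S.map Λ.syzygy).f) :=
    mono_of_mono (G.map (Λ.syzygy.map S.f)) (G.map (Λ.incl S.X₂))
  exact firstVanishes_X₃ (Λ.syzygy_map_shortExact hS) h2

lemma exists_shortExact_syz {S : ShortComplex A} (hS : S.ShortExact) (n : ℕ) :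
    ∃ (f : Λ.syz n S.X₁ ⟶ Λ.syz n S.X₂) (g : Λ.syz n S.X₂ ⟶ Λ.syz n S.X₃) (w : f ≫ g = 0),
      (ShortComplex.mk f g w).ShortExact := by
  induction n with
  | zero => exact ⟨S.f, S.g, S.zero, hS⟩
  | succ n ih =>
    obtain ⟨f, g, w, h⟩ := ih
    exact ⟨_, _, _, Λ.syzygy_map_shortExact h⟩

lemma IsAcyclicFor.mono_map {S : ShortComplex A} (hS : S.ShortExact)
    (h : Λ.IsAcyclicFor G S.X₃) : Mono (G.map S.f) :=
  mono_map_of_firstVanishes hS (h 0)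

lemma IsAcyclicFor.map_shortExact {S : ShortComplex A} (hS : S.ShortExact)
    (h : Λ.IsAcyclicFor G S.X₃) : (S.map G).ShortExact :=
  .mk' (map_exact_and_epi G hS).1 (h.mono_map hS) (map_exact_and_epi G hS).2

lemma isAcyclicFor_X₁ {S : ShortComplex A} (hS : S.ShortExact)
    (h2 : Λ.IsAcyclicFor G S.X₂) (h3 : Λ.IsAcyclicFor G S.X₃) : Λ.IsAcyclicFor G S.X₁ := by
  intro n
  obtain ⟨f, g, w, h⟩ := exists_shortExact_syz (Λ := Λ) hS n
  exact firstVanishes_X₁ h (h2 n) (h3 (n + 1))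

lemma isAcyclicFor_X₃ {S : ShortComplex A} (hS : S.ShortExact)
    (h1 : Λ.IsAcyclicFor G S.X₁) (h2 : Λ.IsAcyclicFor G S.X₂) [Mono (G.map S.f)] :
    Λ.IsAcyclicFor G S.X₃ := by
  rintro (_ | n)
  · exact firstVanishes_X₃ hS (h2 0)
  · obtain ⟨f, g, w, h⟩ := exists_shortExact_syz (Λ := Λ) hS n
    exact firstVanishes_syzygy_X₃ h (h1 n) (h2 (n + 1))

/-- If the derived functors vanish in high degrees, then each object with an infinite coresolution
by acyclic objects is acyclic. -/
lemma isAcyclicFor_of_coresolution {n : ℕ} (hn : ∀ X i, n ≤ i → Λ.FirstVanishes G (Λ.syz i X))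
    (Z K : ℕ → A) (f : ∀ k, Z k ⟶ K k) (g : ∀ k, K k ⟶ Z (k + 1)) (w : ∀ k, f k ≫ g k = 0)
    (hS : ∀ k, (ShortComplex.mk _ _ (w k)).ShortExact) (hK : ∀ k, Λ.IsAcyclicFor G (K k)) (k : ℕ) :
    Λ.IsAcyclicFor G (Z k) := by
  -- Each step along the coresolution raises the derived degree by one, so `m` steps reach the range
  -- of vanishing.
  have key : ∀ m i k, n ≤ i + m → Λ.FirstVanishes G (Λ.syz i (Z k)) := by
    intro m
    induction m with
    | zero => exact fun i k hi => hn _ i hi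
    | succ m ih =>
      intro i k hi
      obtain ⟨f, g, w, h⟩ := exists_shortExact_syz (Λ := Λ) (hS k) i
      exact firstVanishes_X₁ h (hK k i) (ih (i + 1) (k + 1) (by lia))
  exact fun i => key n i k (by lia)

lemma isAcyclicFor_of_int_sequence {n : ℕ} (hn : ∀ X i, n ≤ i → Λ.FirstVanishes G (Λ.syz i X))
    (Z : ℤ → A) (h : ∀ i j, j + 1 = i → ∃ (K : A) (f : Z i ⟶ K) (g : K ⟶ Z j) (w : f ≫ g = 0),
      Λ.IsAcyclicFor G K ∧ (ShortComplex.mk f g w).ShortExact) (i : ℤ) :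
    Λ.IsAcyclicFor G (Z i) := by
  choose K f g w hK hS using
    fun k : ℕ => h (i - k) (i - (k + 1 : ℕ)) (by push_cast; ring)
  have := isAcyclicFor_of_coresolution hn (fun k => Z (i - k)) K f g w hS hK 0
  simpa using this

/-- `G` keeps the sequences of cycles short exact, and splicing their images recovers the image of
the complex. -/
lemma acyclic_map_of_isAcyclicFor_cycles {K : ChainComplex A ℤ} (hK : K.Acyclic)
    (h : ∀ i, Λ.IsAcyclicFor G (K.cycles i)) :
    ((G.mapHomologicalComplex (ComplexShape.down ℤ)).obj K).Acyclic := by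
  intro i
  obtain ⟨j, rfl⟩ : ∃ j, i = j + 1 := ⟨i - 1, by simp⟩
  rw [HomologicalComplex.exactAt_iff' _ (j + 1 + 1) (j + 1) j (by simp) (by simp),
    ShortComplex.exact_iff_exact_up_to_refinements]
  intro W x hx
  change W ⟶ G.obj (K.X (j + 1)) at x
  change x ≫ G.map (K.d (j + 1) j) = 0 at hx
  obtain ⟨w, hS⟩ := K.exists_shortExact_cycles hK (rfl : j + 1 = j + 1)
  obtain ⟨w', hS'⟩ := K.exists_shortExact_cycles hK (rfl : j + 1 + 1 = j + 1 + 1)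
  obtain ⟨w'', hS''⟩ := K.exists_shortExact_cycles hK (sub_add_cancel j 1)
  have hG := (h j).map_shortExact hS
  have : Epi (G.map (K.toCycles (j + 1 + 1) (j + 1))) := (map_exact_and_epi G hS').2
  have : Mono (G.map (K.iCycles j)) := (h (j - 1)).mono_map hS''
  have hx' : x ≫ G.map (K.toCycles (j + 1) j) = 0 := by
    rw [← cancel_mono (G.map (K.iCycles j)), Category.assoc, ← Functor.map_comp, K.toCycles_i, hx,
      zero_comp]
  obtain ⟨W1, p1, _, y, hy⟩ := ShortComplex.Exact.exists_lift_up_to_refinements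
    (f := G.map (K.iCycles (j + 1))) hG.exact _ hx'
  obtain ⟨W2, p2, _, z, hz⟩ :=
    surjective_up_to_refinements_of_epi (G.map (K.toCycles (j + 1 + 1) (j + 1))) y
  refine ⟨W2, p2 ≫ p1, inferInstance, z, ?_⟩
  change (p2 ≫ p1) ≫ x = z ≫ G.map (K.d (j + 1 + 1) (j + 1))
  rw [Category.assoc, hy, reassoc_of% hz, ← Functor.map_comp, K.toCycles_i]

end Acyclic

/-! ### Comparison with the homology of the canonical resolution -/

section Derived

variable {A : Type*} [Category* A] [Abelian A] {E : Type*} [Category* E] [Abelian E]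
  (Λ : LeftResolution (𝟭 A)) (G : A ⥤ E)

/-- The differential `F (Ω Y) ⟶ F Y`. -/
noncomputable def diff (Y : A) : Λ.F.obj (Λ.syzygy.obj Y) ⟶ Λ.F.obj Y :=
  Λ.proj (Λ.syzygy.obj Y) ≫ Λ.incl Y

/-- The canonical complex is built from kernels of its differentials rather than from syzygies. The
two agree inductively, since the kernel of `F (Ω Y) ⟶ Y' ` with `Y' = F Y` is `Ω (Ω Y)`, as `Ω Y ⟶ F
Y` is mono. -/
lemma exists_iso_chainComplex (X : A) (n : ℕ) :
    ∃ (Y : A) (_ : Y = Λ.syz n X) (e₀ : (Λ.chainComplex X).X n ≅ Λ.F.obj Y)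
      (e₁ : (Λ.chainComplex X).X (n + 1) ≅ Λ.F.obj (Λ.syzygy.obj Y)),
      (Λ.chainComplex X).d (n + 1) n = e₁.hom ≫ Λ.diff Y ≫ e₀.inv := by
  induction n with
  | zero =>
    refine ⟨X, rfl, Λ.chainComplexXZeroIso X, Λ.chainComplexXOneIso X, ?_⟩
    refine (Λ.map_chainComplex_d_1_0 X).trans ?_
    rw [diff, Category.assoc]
    rfl
  | succ n ih =>
    obtain ⟨Y, hY, e₀, e₁, h⟩ := ih
    have hd := Λ.map_chainComplex_d X n
    dsimp at hd
    have hk : kernel.ι ((Λ.chainComplex X).d (n + 1) n) ≫ e₁.hom ≫ Λ.proj (Λ.syzygy.obj Y) = 0 := by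
      rw [← cancel_mono (Λ.incl Y), ← cancel_mono e₀.inv, zero_comp, zero_comp,
        ← kernel.condition ((Λ.chainComplex X).d (n + 1) n)]
      simp only [h, diff, Category.assoc]
    have hk' : Λ.incl (Λ.syzygy.obj Y) ≫ e₁.inv ≫ (Λ.chainComplex X).d (n + 1) n = 0 := by
      rw [h, e₁.inv_hom_id_assoc, diff, Category.assoc, ← Category.assoc, incl_comp_proj, zero_comp]
    let ε : kernel ((Λ.chainComplex X).d (n + 1) n) ≅ Λ.syzygy.obj (Λ.syzygy.obj Y) :=
      { hom := Λ.lift (kernel.ι _ ≫ e₁.hom) (by rw [Category.assoc, hk])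
        inv := kernel.lift _ (Λ.incl _ ≫ e₁.inv) (by rw [Category.assoc, hk'])
        hom_inv_id := by
          rw [← cancel_mono (kernel.ι _), Category.assoc, kernel.lift_ι, ← Category.assoc,
            lift_comp_incl]
          simp
        inv_hom_id := by
          rw [← cancel_mono (Λ.incl _), Category.assoc, lift_comp_incl, kernel.lift_ι_assoc]
          simp }
    have hε : ε.hom ≫ Λ.incl _ = kernel.ι _ ≫ e₁.hom := Λ.lift_comp_incl _ _
    refine ⟨Λ.syzygy.obj Y, by rw [hY]; rfl, e₁, Λ.chainComplexXIso X n ≪≫ Λ.F.mapIso ε, ?_⟩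
    rw [hd, diff, Iso.trans_hom, Functor.mapIso_hom, Category.assoc, Category.assoc,
      ← Category.assoc (Λ.F.map _), map_comp_proj, Category.assoc, reassoc_of% hε, e₁.hom_inv_id,
      Category.comp_id]
    rfl

/-- An element of the kernel of `G Ω Y ⟶ G F Y` lifts to a cycle in `G F Ω Y`. This cycle is a
boundary, and boundaries die in `G Ω Y`. -/
lemma firstVanishes_of_isZero_homology [G.Additive] [PreservesFiniteColimits G] (X : A) (n : ℕ)
    (h : IsZero ((((G.mapHomologicalComplex _).obj (Λ.chainComplex X))).homology (n + 1))) :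
    Λ.FirstVanishes G (Λ.syz n X) := by
  obtain ⟨Y, hY, e₀, e₁, h₁⟩ := Λ.exists_iso_chainComplex X n
  obtain ⟨Y', hY', e₁', e₂, h₂⟩ := Λ.exists_iso_chainComplex X (n + 1)
  obtain rfl : Y' = Λ.syzygy.obj Y := by rw [hY', hY]; rfl
  rw [← hY]
  rw [← HomologicalComplex.exactAt_iff_isZero_homology,
    HomologicalComplex.exactAt_iff' _ (n + 2) (n + 1) n (by simp) (by simp)] at h
  have hd : (Λ.chainComplex X).d (n + 2) (n + 1) ≫ e₁.hom ≫ Λ.proj (Λ.syzygy.obj Y) = 0 := by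
    rw [← cancel_mono (Λ.incl Y), ← cancel_mono e₀.inv, zero_comp, zero_comp,
      ← (Λ.chainComplex X).d_comp_d (n + 2) (n + 1) n]
    simp only [h₁, diff, Category.assoc]
  have hG : Epi (G.map (Λ.proj (Λ.syzygy.obj Y))) :=
    (map_exact_and_epi G (Λ.syzygySeq_shortExact (Λ.syzygy.obj Y))).2
  refine Preadditive.mono_of_cancel_zero _ fun {W} a ha => ?_
  obtain ⟨W1, p1, _, b, hb⟩ :=
    surjective_up_to_refinements_of_epi (G.map (Λ.proj (Λ.syzygy.obj Y))) a
  have e : (b ≫ G.map e₁.inv) ≫ G.map ((Λ.chainComplex X).d (n + 1) n) = 0 := by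
    rw [h₁, Category.assoc, ← Functor.map_comp, e₁.inv_hom_id_assoc, diff, Category.assoc,
      Functor.map_comp, ← reassoc_of% hb, Functor.map_comp, reassoc_of% ha, zero_comp, comp_zero]
  obtain ⟨W2, p2, _, c, hc⟩ := ShortComplex.Exact.exists_lift_up_to_refinements
    (f := G.map ((Λ.chainComplex X).d (n + 2) (n + 1))) h _ e
  have hc' := hc =≫ G.map e₁.hom
  rw [Category.assoc, Category.assoc, ← Functor.map_comp, e₁.inv_hom_id, Functor.map_id,
    Category.comp_id] at hc'
  have : Epi (p2 ≫ p1) := inferInstance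
  rw [← cancel_epi (p2 ≫ p1), Category.assoc, hb, reassoc_of% hc', ← Functor.map_comp,
    ← Functor.map_comp, hd, Functor.map_zero, comp_zero, comp_zero]

end Derived

end CategoryTheory.Abelian.LeftResolution

/-! ### Splicing short exact sequences indexed by the integers -/

namespace GorensteinLift

lemma exists_int_sequence {α : Type*} (R : α → α → Prop) (hu : ∀ x, ∃ y, R y x)
    (hd : ∀ x, ∃ y, R x y) (x : α) : ∃ Z : ℤ → α, Z 0 = x ∧ ∀ i, R (Z (i + 1)) (Z i) := by
  choose u hu using hu
  choose d hd using hd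
  refine ⟨fun i => match i with
    | Int.ofNat n => u^[n] x
    | Int.negSucc n => d^[n + 1] x, rfl, ?_⟩
  rintro (n | _ | n)
  · change R (u^[n + 1] x) (u^[n] x)
    rw [Function.iterate_succ_apply']
    exact hu _
  · exact hd x
  · change R (d^[n + 1] x) (d^[n + 2] x)
    rw [Function.iterate_succ_apply' d (n + 1)]
    exact hd _

section

variable {A : Type u} [Category.{v} A] [Abelian A]

variable (Z M : ℤ → A) (f : ∀ i, Z (i + 1) ⟶ M i) (g : ∀ i, M i ⟶ Z i) (w : ∀ i, f i ≫ g i = 0)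

/-- The complex obtained by splicing short exact sequences `0 ⟶ Z (i + 1) ⟶ M i ⟶ Z i ⟶ 0`. -/
noncomputable abbrev splice : ChainComplex A ℤ :=
  ChainComplex.of M (fun i => g (i + 1) ≫ f i) fun i => by
    rw [Category.assoc, ← Category.assoc (f (i + 1)), w, zero_comp, comp_zero]

lemma splice_d (i : ℤ) : (splice Z M f g w).d (i + 1) i = g (i + 1) ≫ f i :=
  ChainComplex.of_d M (fun i => g (i + 1) ≫ f i) i

variable {Z M f g w} (hS : ∀ i, (ShortComplex.mk (f i) (g i) (w i)).ShortExact)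
include hS

lemma splice_acyclic : (splice Z M f g w).Acyclic := by
  intro i
  obtain ⟨j, rfl⟩ : ∃ j, i = j + 1 := ⟨i - 1, by simp⟩
  rw [HomologicalComplex.exactAt_iff' _ (j + 1 + 1) (j + 1) j (by simp) (by simp),
    ShortComplex.exact_iff_exact_up_to_refinements]
  intro W x hx
  change W ⟶ M (j + 1) at x
  change x ≫ (splice Z M f g w).d (j + 1) j = 0 at hx
  have : Mono (f j) := (hS j).mono_f
  have : Epi (g (j + 1 + 1)) := (hS (j + 1 + 1)).epi_g
  rw [splice_d, ← Category.assoc, ← zero_comp (f := f j), cancel_mono] at hx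
  obtain ⟨W1, p1, _, y, hy⟩ := (hS (j + 1)).exact.exists_lift_up_to_refinements x hx
  obtain ⟨W2, p2, _, z, hz⟩ := surjective_up_to_refinements_of_epi (g (j + 1 + 1)) y
  refine ⟨W2, p2 ≫ p1, inferInstance, z, ?_⟩
  change (p2 ≫ p1) ≫ x = z ≫ (splice Z M f g w).d (j + 1 + 1) (j + 1)
  rw [splice_d]
  change (p2 ≫ p1) ≫ x = z ≫ g (j + 1 + 1) ≫ f (j + 1)
  rw [Category.assoc, hy, reassoc_of% hz]

lemma nonempty_cycles_splice_iso (i : ℤ) :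
    Nonempty (Z (i + 1) ≅ (splice Z M f g w).cycles i) := by
  obtain ⟨j, rfl⟩ : ∃ j, i = j + 1 := ⟨i - 1, by simp⟩
  have : Mono (f j) := (hS j).mono_f
  have h1 := (splice Z M f g w).cyclesIsKernel (j + 1) j (by simp)
  have h2 := isKernelCompMono (hS (j + 1)).fIsKernel (f j) (splice_d Z M f g w j)
  exact ⟨h2.conePointUniqueUpToIso h1⟩

end

/-! ### Gorenstein projective objects through `Ext` and cosyzygies -/

section

open Abelian

attribute [local instance] HasExt.standard

variable {A : Type u} [Category.{v} A] [Abelian A]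

/-- The groups `Ext ^ i (X, P)` vanish for all `i > 0` and all projective objects `P`. -/
def ExtVanishes (X : A) : Prop :=
  ∀ P : A, Projective P → ∀ (n : ℕ) (x : Ext.{max u v} X P (n + 1)), x = 0

lemma ext_one_eq_zero_of_extends {S : ShortComplex A} (hS : S.ShortExact) [Projective S.X₂] {P : A}
    (h : ∀ φ : S.X₁ ⟶ P, ∃ ψ : S.X₂ ⟶ P, S.f ≫ ψ = φ) (x : Ext.{max u v} S.X₃ P 1) : x = 0 := by
  obtain ⟨y, hy⟩ := Ext.contravariant_sequence_exact₃ hS P x (Ext.eq_zero_of_projective _)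
    (add_zero 1)
  obtain ⟨φ, rfl⟩ := Ext.mk₀_bijective _ _ |>.2 y
  obtain ⟨ψ, rfl⟩ := h φ
  rw [← hy, ← Ext.mk₀_comp_mk₀, ShortComplex.ShortExact.extClass_comp_assoc]

lemma exists_extension {S : ShortComplex A} (hS : S.ShortExact) {P : A}
    (h : ∀ x : Ext.{max u v} S.X₃ P 1, x = 0) (φ : S.X₁ ⟶ P) : ∃ ψ : S.X₂ ⟶ P, S.f ≫ ψ = φ := by
  obtain ⟨y, hy⟩ := Ext.contravariant_sequence_exact₁ hS P (Ext.mk₀ φ) (add_zero 1) (h _)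
  obtain ⟨ψ, rfl⟩ := Ext.mk₀_bijective _ _ |>.2 y
  rw [Ext.mk₀_comp_mk₀] at hy
  exact ⟨ψ, Ext.mk₀_bijective _ _ |>.1 hy⟩

lemma ext_eq_zero_X₃ {S : ShortComplex A} (hS : S.ShortExact) [Projective S.X₂] {P : A} {n : ℕ}
    (h : ∀ x : Ext.{max u v} S.X₁ P (n + 1), x = 0) (x : Ext.{max u v} S.X₃ P (n + 2)) : x = 0 := by
  obtain ⟨y, hy⟩ := Ext.contravariant_sequence_exact₃ hS P x (Ext.eq_zero_of_projective _)
    (n₀ := n + 1) (by lia)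
  rw [← hy, h y, Ext.comp_zero]

lemma ExtVanishes.X₁ {S : ShortComplex A} (hS : S.ShortExact) (h₂ : ExtVanishes S.X₂)
    (h₃ : ExtVanishes S.X₃) : ExtVanishes S.X₁ := by
  intro P hP n x
  obtain ⟨y, rfl⟩ := Ext.contravariant_sequence_exact₁ hS P x (n₁ := n + 2) (by lia)
    (h₃ P hP (n + 1) _)
  rw [h₂ P hP n y, Ext.comp_zero]

lemma ExtVanishes.X₂ {S : ShortComplex A} (hS : S.ShortExact) (h₁ : ExtVanishes S.X₁)
    (h₃ : ExtVanishes S.X₃) : ExtVanishes S.X₂ := by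
  intro P hP n x
  obtain ⟨y, rfl⟩ := Ext.contravariant_sequence_exact₂ hS P x (h₁ P hP n _)
  rw [h₃ P hP n y, Ext.comp_zero]

lemma ExtVanishes.of_projective {Q : A} (hQ : Projective Q) : ExtVanishes Q :=
  fun _ _ _ _ => Ext.eq_zero_of_projective _

lemma ExtVanishes.of_retract {X Y : A} (r : Retract X Y) (h : ExtVanishes Y) : ExtVanishes X := by
  intro P hP n x
  have : (Ext.mk₀ r.i).comp ((Ext.mk₀ r.r).comp x (zero_add _)) (zero_add _) = x := by
    rw [← Ext.comp_assoc_of_second_deg_zero, Ext.mk₀_comp_mk₀, r.retract, Ext.mk₀_id_comp]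
  rw [← this, h P hP n ((Ext.mk₀ r.r).comp x (zero_add _)), Ext.comp_zero]

lemma ExtVanishes.exists_extension {S : ShortComplex A} (hS : S.ShortExact) {P : A}
    (hP : Projective P) (h : ExtVanishes S.X₃) (φ : S.X₁ ⟶ P) : ∃ ψ : S.X₂ ⟶ P, S.f ≫ ψ = φ :=
  GorensteinLift.exists_extension hS (h P hP 0) φ

/-- A coinductive criterion for the vanishing of `Ext ^ i (X, P)` for `i > 0`. -/
lemma extVanishes_of_class {C : ObjectProperty A} (P : A)
    (h : ∀ X, C X → ∃ (X' Q : A) (f : X' ⟶ Q) (g : Q ⟶ X) (w : f ≫ g = 0),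
      C X' ∧ Projective Q ∧ (ShortComplex.mk f g w).ShortExact ∧
        ∀ φ : X' ⟶ P, ∃ ψ : Q ⟶ P, f ≫ ψ = φ) (n : ℕ) :
    ∀ X, C X → ∀ x : Ext.{max u v} X P (n + 1), x = 0 := by
  induction n with
  | zero =>
    intro X hX
    obtain ⟨X', Q, f, g, w, hX', hQ, hS, hφ⟩ := h X hX
    exact ext_one_eq_zero_of_extends hS hφ
  | succ n ih =>
    intro X hX
    obtain ⟨X', Q, f, g, w, hX', hQ, hS, hφ⟩ := h X hX
    exact ext_eq_zero_X₃ hS (ih X' hX')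

/-- There is a short exact sequence `0 ⟶ X' ⟶ Q ⟶ X ⟶ 0` with `Q` projective. -/
def IsSyzygyOf (X' X : A) : Prop :=
  ∃ (Q : A) (f : X' ⟶ Q) (g : Q ⟶ X) (w : f ≫ g = 0),
    Projective Q ∧ (ShortComplex.mk f g w).ShortExact

lemma IsSyzygyOf.of_epi {X Q : A} (hQ : Projective Q) (p : Q ⟶ X) [Epi p] :
    IsSyzygyOf (kernel p) X :=
  ⟨Q, kernel.ι p, p, kernel.condition p, hQ,
    .mk' (ShortComplex.exact_kernel p) inferInstance inferInstance⟩

/-- For an acyclic complex of projectives, acyclicity of `Hom(-, Q)` says that maps from cycles to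
`Q` extend to the next term. This is `Ext¹` vanishing for all cycles, and dimension shifting gives
the higher degrees. -/
lemma gorensteinProjective_iff (X : A) : gorensteinProjective A X ↔
    ∃ Z : ℤ → A, Nonempty (X ≅ Z 0) ∧ ∀ i, IsSyzygyOf (Z (i + 1)) (Z i) ∧ ExtVanishes (Z i) := by
  constructor
  · rintro ⟨K, hK, ⟨e⟩⟩
    have key : ∀ i, ∃ w : K.iCycles (i + 1) ≫ K.toCycles (i + 1) i = 0,
        (ShortComplex.mk (K.iCycles (i + 1)) (K.toCycles (i + 1) i) w).ShortExact :=
      fun i => K.exists_shortExact_cycles hK.acyclic rfl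
    refine ⟨fun i => K.cycles i, ⟨e⟩, fun i => ⟨?_, ?_⟩⟩
    · obtain ⟨w, hS⟩ := key i
      exact ⟨_, _, _, w, hK.projective _, hS⟩
    · intro P hP n
      refine extVanishes_of_class (C := fun X => ∃ i, X = K.cycles i) P ?_ n _ ⟨i, rfl⟩
      rintro _ ⟨i, rfl⟩
      obtain ⟨w, hS⟩ := key i
      refine ⟨_, _, _, _, w, ⟨_, rfl⟩, hK.projective _, hS, fun φ => ?_⟩
      obtain ⟨w', hS'⟩ := key (i + 1)
      have hepi : Epi (K.toCycles (i + 1 + 1) (i + 1)) := hS'.epi_g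
      obtain ⟨h, hh⟩ := hK.hom_acyclic P hP (i + 1 + 1) (K.toCycles (i + 1 + 1) (i + 1) ≫ φ)
        (by simp)
      have e1 : i + 1 + 1 - 1 = i + 1 := by simp
      generalize i + 1 + 1 - 1 = j at h hh e1
      subst e1
      refine ⟨h, ?_⟩
      rw [← cancel_epi (K.toCycles (i + 1 + 1) (i + 1)), ← hh, ← Category.assoc, K.toCycles_i]
  · rintro ⟨Z, ⟨e⟩, hZ⟩
    -- The spliced complex has `Z (i + 1)` as its cycles in degree `i`, so the sequence is shifted
    -- by one.
    obtain ⟨Z, ⟨e⟩, hZ⟩ : ∃ Z : ℤ → A, Nonempty (X ≅ Z (0 + 1)) ∧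
        ∀ i, IsSyzygyOf (Z (i + 1)) (Z i) ∧ ExtVanishes (Z i) := by
      refine ⟨fun i => Z (i - 1), ⟨e ≪≫ eqToIso (by simp)⟩, fun i => ⟨?_, (hZ (i - 1)).2⟩⟩
      change IsSyzygyOf (Z (i + 1 - 1)) (Z (i - 1))
      rw [show i + 1 - 1 = i - 1 + 1 by ring]
      exact (hZ (i - 1)).1
    choose M f g w hM hS using fun i => (hZ i).1
    obtain ⟨e'⟩ := nonempty_cycles_splice_iso hS 0
    refine ⟨splice Z M f g w, ⟨hM, splice_acyclic hS, ?_⟩, ⟨e ≪≫ e'⟩⟩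
    intro P hP i φ hφ
    obtain ⟨j, rfl⟩ : ∃ j, i = j + 1 := ⟨i - 1, by simp⟩
    change M (j + 1) ⟶ P at φ
    rw [splice_d] at hφ
    change (g (j + 1 + 1) ≫ f (j + 1)) ≫ φ = 0 at hφ
    have h1 : Epi (g (j + 1 + 1)) := (hS (j + 1 + 1)).epi_g
    have h2 : Epi (g (j + 1)) := (hS (j + 1)).epi_g
    rw [Category.assoc, ← comp_zero (f := g (j + 1 + 1)), cancel_epi] at hφ
    obtain ⟨χ, hχ⟩ : ∃ χ : Z (j + 1) ⟶ P, g (j + 1) ≫ χ = φ :=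
      ⟨_, (hS (j + 1)).exact.g_desc φ hφ⟩
    obtain ⟨ψ, hψ⟩ := (hZ j).2.exists_extension (hS j) hP χ
    have e1 : j + 1 - 1 = j := by simp
    generalize j + 1 - 1 = k at e1
    subst e1
    refine ⟨ψ, ?_⟩
    rw [splice_d]
    change (g (k + 1) ≫ f k) ≫ ψ = φ
    rw [Category.assoc, hψ, hχ]

lemma gorensteinProjective.extVanishes {X : A} (h : gorensteinProjective A X) : ExtVanishes X := by
  obtain ⟨Z, ⟨e⟩, hZ⟩ := (gorensteinProjective_iff X).1 h
  exact (hZ 0).2.of_retract e.retract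

lemma IsSyzygyOf.of_iso {X' Y' X Y : A} (h : IsSyzygyOf X' X) (e' : Y' ≅ X') (e : X ≅ Y) :
    IsSyzygyOf Y' Y := by
  obtain ⟨Q, f, g, w, hQ, hS⟩ := h
  refine ⟨Q, e'.hom ≫ f, g ≫ e.hom, by simp [reassoc_of% w], hQ, ?_⟩
  refine ShortComplex.shortExact_of_iso (S₁ := ShortComplex.mk f g w) ?_ hS
  exact ShortComplex.isoMk e'.symm (Iso.refl _) e

lemma gorensteinProjective.exists_cosyzygy {X : A} (h : gorensteinProjective A X) :
    ∃ Y, gorensteinProjective A Y ∧ IsSyzygyOf X Y := by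
  obtain ⟨Z, ⟨e⟩, hZ⟩ := (gorensteinProjective_iff X).1 h
  refine ⟨Z (-1), (gorensteinProjective_iff _).2 ⟨fun i => Z (i - 1), ⟨Iso.refl _⟩, fun i => ?_⟩,
    (hZ (-1)).1.of_iso (e ≪≫ eqToIso (by simp)) (Iso.refl _)⟩
  change IsSyzygyOf (Z (i + 1 - 1)) (Z (i - 1)) ∧ ExtVanishes (Z (i - 1))
  rw [show i + 1 - 1 = i - 1 + 1 by ring]
  exact hZ (i - 1)

lemma gorensteinProjective.exists_syzygy {X : A} (h : gorensteinProjective A X) :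
    ∃ Y, gorensteinProjective A Y ∧ IsSyzygyOf Y X := by
  obtain ⟨Z, ⟨e⟩, hZ⟩ := (gorensteinProjective_iff X).1 h
  exact ⟨Z (0 + 1), (gorensteinProjective_iff _).2 ⟨fun i => Z (i + 1), ⟨Iso.refl _⟩,
    fun i => hZ (i + 1)⟩, (hZ 0).1.of_iso (Iso.refl _) e.symm⟩

/-- The closure of a class of objects under syzygies. -/
inductive SyzygyClosure (C : ObjectProperty A) : A → Prop
  | base {X : A} : C X → SyzygyClosure C X
  | step {X' X : A} : SyzygyClosure C X → IsSyzygyOf X' X → SyzygyClosure C X'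

/-- A coinductive criterion for Gorenstein projectivity. -/
lemma gorensteinProjective_of_class [EnoughProjectives A] {C : ObjectProperty A}
    (h₁ : ∀ X, C X → ExtVanishes X) (h₂ : ∀ X, C X → ∃ Y, C Y ∧ IsSyzygyOf X Y) {X : A}
    (hX : C X) : gorensteinProjective A X := by
  have hE : ∀ X, SyzygyClosure C X → ExtVanishes X := by
    intro X hX
    induction hX with
    | base h => exact h₁ _ h
    | step _ h ih =>
      obtain ⟨Q, f, g, w, hQ, hS⟩ := h
      exact .X₁ hS (.of_projective hQ) ih
  -- Towards syzygies, projective presentations continue the sequence. Towards cosyzygies, members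
  -- of `C` use `h₂`, and any other member of the closure was itself obtained as a syzygy.
  obtain ⟨Z, hZ₀, hZ⟩ := exists_int_sequence
    (fun X Y : Subtype (SyzygyClosure C) => IsSyzygyOf X.1 Y.1)
    (fun X => ⟨⟨_, .step X.2 (.of_epi inferInstance (Projective.π X.1))⟩,
      .of_epi inferInstance _⟩)
    (by
      rintro ⟨X, hX | ⟨hX, h⟩⟩
      · obtain ⟨Y, hY, h⟩ := h₂ _ hX
        exact ⟨⟨Y, .base hY⟩, h⟩
      · exact ⟨⟨_, hX⟩, h⟩)
    ⟨X, .base hX⟩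
  rw [gorensteinProjective_iff]
  exact ⟨fun i => (Z i).1, ⟨eqToIso (congrArg Subtype.val hZ₀).symm⟩, fun i => ⟨hZ i, hE _ (Z i).2⟩⟩

/-- An object with vanishing `Ext` is Gorenstein projective if it is a syzygy of a Gorenstein
projective object. -/
lemma gorensteinProjective_of_isSyzygyOf [EnoughProjectives A] {X Y : A} (hX : ExtVanishes X)
    (h : IsSyzygyOf X Y) (hY : gorensteinProjective A Y) : gorensteinProjective A X := by
  refine gorensteinProjective_of_class
    (C := fun W => ExtVanishes W ∧ ∃ Y, gorensteinProjective A Y ∧ IsSyzygyOf W Y)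
    (fun W hW => hW.1) ?_ ⟨hX, Y, hY, h⟩
  rintro W ⟨-, Y, hY, h⟩
  exact ⟨Y, ⟨hY.extVanishes, hY.exists_cosyzygy⟩, h⟩

lemma gorensteinProjective_X₁ [EnoughProjectives A] {S : ShortComplex A} (hS : S.ShortExact)
    (h₂ : Projective S.X₂) (h₃ : gorensteinProjective A S.X₃) : gorensteinProjective A S.X₁ :=
  gorensteinProjective_of_isSyzygyOf (.X₁ hS (.of_projective h₂) h₃.extVanishes)
    ⟨_, _, _, S.zero, h₂, hS⟩ h₃

/-- Adding the identity of `Q` to a cosyzygy sequence of `G` leaves its cokernel unchanged. -/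
lemma gorensteinProjective_biprod [EnoughProjectives A] {Q G : A} (hQ : Projective Q)
    (hG : gorensteinProjective A G) : gorensteinProjective A (Q ⊞ G) := by
  obtain ⟨Y, hY, K, f, g, w, hK, hS⟩ := hG.exists_cosyzygy
  have : Mono f := hS.mono_f
  have : Epi g := hS.epi_g
  refine gorensteinProjective_of_isSyzygyOf (Y := Y) ?_
    ⟨Q ⊞ K, biprod.map (𝟙 Q) f, biprod.snd ≫ g, by simp [w], inferInstance, ?_⟩ hY
  · exact .X₂ (S := ShortComplex.mk (biprod.inl : Q ⟶ Q ⊞ G) biprod.snd (by simp))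
      (ShortComplex.Splitting.ofHasBinaryBiproduct Q G).shortExact (.of_projective hQ)
      hG.extVanishes
  · refine .mk' ?_ (inferInstanceAs (Mono (biprod.map (𝟙 Q) f))) (epi_comp biprod.snd g)
    rw [ShortComplex.exact_iff_exact_up_to_refinements]
    intro W x hx
    obtain ⟨W1, p1, _, y, hy⟩ := hS.exact.exists_lift_up_to_refinements (x ≫ biprod.snd)
      (by rw [Category.assoc]; exact hx)
    refine ⟨W1, p1, inferInstance, biprod.lift (p1 ≫ x ≫ biprod.fst) y, ?_⟩
    apply biprod.hom_ext
    · simp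
    · simpa using hy

/-- The cokernel of a monomorphism from a Gorenstein projective object to a projective object is
Gorenstein projective if all morphisms to projective objects extend along the monomorphism. -/
lemma gorensteinProjective_X₃ [EnoughProjectives A] {S : ShortComplex A} (hS : S.ShortExact)
    (h₂ : Projective S.X₂) (h₁ : gorensteinProjective A S.X₁)
    (h : ∀ P : A, Projective P → ∀ φ : S.X₁ ⟶ P, ∃ ψ : S.X₂ ⟶ P, S.f ≫ ψ = φ) :
    gorensteinProjective A S.X₃ := by
  have hE : ExtVanishes S.X₃ := by
    rintro P hP (_ | n)
    · exact ext_one_eq_zero_of_extends hS (h P hP)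
    · exact ext_eq_zero_X₃ hS (h₁.extVanishes P hP n)
  -- The maps `t` and `s` compare two embeddings of `X₁` in projectives to which all maps into
  -- projectives extend. A Schanuel argument would give `X₃ ⊞ Q ≅ X₂ ⊞ G₁`; instead of passing to a
  -- summand, the proof builds a cosyzygy of `X₃` directly.
  obtain ⟨G₁, hG₁, Q, j, p, w, hQ, hT⟩ := h₁.exists_cosyzygy
  obtain ⟨G₂, hG₂, Q₁, k, π, w₁, hQ₁, hU⟩ := hG₁.exists_cosyzygy
  have : Mono k := hU.mono_f
  have : Epi p := hT.epi_g
  have : Epi π := hU.epi_g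
  have := hS.epi_g
  obtain ⟨t, ht⟩ := h Q hQ j
  obtain ⟨s, hs⟩ : ∃ s : Q ⟶ S.X₂, j ≫ s = S.f := hG₁.extVanishes.exists_extension hT h₂ S.f
  obtain ⟨c, hc⟩ : ∃ c : S.X₃ ⟶ S.X₂, S.g ≫ c = 𝟙 _ - t ≫ s :=
    ⟨_, hS.exact.g_desc (𝟙 _ - t ≫ s) (by simp [reassoc_of% ht, hs])⟩
  obtain ⟨τ, hτ⟩ : ∃ τ : S.X₃ ⟶ G₁, S.g ≫ τ = t ≫ p :=
    ⟨_, hS.exact.g_desc (t ≫ p) (by simp [reassoc_of% ht, w])⟩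
  obtain ⟨v, hv⟩ : ∃ v : G₁ ⟶ Q, p ≫ v = 𝟙 _ - s ≫ t :=
    ⟨_, hT.exact.g_desc (𝟙 _ - s ≫ t) (by simp [reassoc_of% hs, ht])⟩
  obtain ⟨e, he⟩ : ∃ e : Q₁ ⟶ Q, k ≫ e = v := hG₂.extVanishes.exists_extension hU hQ v
  -- The sequence is `0 ⟶ X₃ ⟶ X₂ ⊞ Q₁ ⟶ Q ⊞ G₂ ⟶ 0`: the split inclusion of `X₃` in `X₂ ⊞ G₁`, with
  -- complement `Q`, followed by `k : G₁ ⟶ Q₁`.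
  refine gorensteinProjective_of_isSyzygyOf hE ⟨S.X₂ ⊞ Q₁, biprod.lift c (τ ≫ k),
    biprod.lift (biprod.fst ≫ t - biprod.snd ≫ e) (biprod.snd ≫ π), ?_, inferInstance,
    .mk' ?_ ?_ ?_⟩ (gorensteinProjective_biprod hQ hG₂)
  · rw [← cancel_epi S.g]
    apply biprod.hom_ext
    · simp [reassoc_of% hc, he, reassoc_of% hτ, hv]
    · simp [w₁]
  · rw [ShortComplex.exact_iff_exact_up_to_refinements]
    intro W x hx
    change W ⟶ S.X₂ ⊞ Q₁ at x
    have hx₁ : x ≫ biprod.fst ≫ t = x ≫ biprod.snd ≫ e := by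
      simpa [sub_eq_zero] using hx =≫ biprod.fst
    have hx₂ : (x ≫ biprod.snd) ≫ π = 0 := by simpa using hx =≫ biprod.snd
    obtain ⟨W1, p1, _, g, hg⟩ := hU.exact.exists_lift_up_to_refinements _ hx₂
    obtain ⟨W2, p2, _, a, ha⟩ := surjective_up_to_refinements_of_epi p g
    have hr : (p2 ≫ p1 ≫ x ≫ biprod.fst + a ≫ s) ≫ t = a := by
      have h1 : p2 ≫ p1 ≫ x ≫ biprod.fst ≫ t = a - a ≫ s ≫ t := by
        rw [hx₁, reassoc_of% hg, he, reassoc_of% ha, hv]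
        simp
      simp [h1]
    have e₁ : (p2 ≫ p1) ≫ x ≫ biprod.fst =
        ((p2 ≫ p1 ≫ x ≫ biprod.fst + a ≫ s) ≫ S.g) ≫ c := by
      rw [Category.assoc _ S.g, hc, Preadditive.comp_sub, ← Category.assoc _ t s, hr]
      simp
    have e₂ : (p2 ≫ p1) ≫ x ≫ biprod.snd =
        ((p2 ≫ p1 ≫ x ≫ biprod.fst + a ≫ s) ≫ S.g) ≫ τ ≫ k := by
      rw [Category.assoc _ S.g, reassoc_of% hτ, ← Category.assoc _ t, hr, Category.assoc, hg,
        reassoc_of% ha]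
    refine ⟨W2, p2 ≫ p1, inferInstance, (p2 ≫ p1 ≫ x ≫ biprod.fst + a ≫ s) ≫ S.g, ?_⟩
    generalize (p2 ≫ p1 ≫ x ≫ biprod.fst + a ≫ s) ≫ S.g = ρ at e₁ e₂
    change (p2 ≫ p1) ≫ x = ρ ≫ biprod.lift c (τ ≫ k)
    apply biprod.hom_ext
    · simpa using e₁
    · simpa using e₂
  · refine Preadditive.mono_of_cancel_zero _ fun {W} x hx => ?_
    change W ⟶ S.X₃ at x
    have hx₁ : x ≫ c = 0 := by simpa using hx =≫ biprod.fst
    have hx₂ : x ≫ τ = 0 := by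
      rw [← cancel_mono k]
      simpa using hx =≫ biprod.snd
    obtain ⟨W1, p1, _, r, hr⟩ := surjective_up_to_refinements_of_epi S.g x
    have h1 : r = (r ≫ t) ≫ s := by
      have := congrArg (p1 ≫ ·) hx₁
      simpa [reassoc_of% hr, hc, sub_eq_zero] using this
    obtain ⟨W2, p2, _, y, hy⟩ := hT.exact.exists_lift_up_to_refinements (r ≫ t)
      (by rw [Category.assoc, ← hτ, ← reassoc_of% hr, hx₂, comp_zero])
    have : Epi (p2 ≫ p1) := inferInstance
    rw [← cancel_epi (p2 ≫ p1), Category.assoc, hr, h1, Category.assoc,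
      ← Category.assoc p2, hy, Category.assoc, reassoc_of% hs, S.zero, comp_zero, comp_zero]
  · rw [epi_iff_surjective_up_to_refinements]
    intro W y
    change W ⟶ Q ⊞ G₂ at y
    obtain ⟨W1, p1, _, b, hb⟩ := surjective_up_to_refinements_of_epi π (y ≫ biprod.snd)
    let a : W1 ⟶ Q := p1 ≫ y ≫ biprod.fst + b ≫ e
    refine ⟨W1, p1, inferInstance, biprod.lift (a ≫ s) (b - a ≫ p ≫ k), ?_⟩
    apply biprod.hom_ext
    · simp [he, hv, a]
      abel
    · simp [w₁, hb]

end

end GorensteinLift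

/-! ### Exactness and acyclicity for a Nakayama functor -/

namespace GorensteinLift

open Abelian Opposite

section

variable {A : Type*} [Category* A] {D : Type*} [Category* D] {L : D ⥤ A} {R : A ⥤ D}
  (adj : L ⊣ R)

include adj in
lemma exists_extension_iff {X Y : D} (f : X ⟶ Y) (P : A) :
    (∀ φ : L.obj X ⟶ P, ∃ ψ : L.obj Y ⟶ P, L.map f ≫ ψ = φ) ↔
      ∀ φ : X ⟶ R.obj P, ∃ ψ : Y ⟶ R.obj P, f ≫ ψ = φ := by
  constructor
  · intro h φ
    obtain ⟨ψ, hψ⟩ := h ((adj.homEquiv _ _).symm φ)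
    refine ⟨adj.homEquiv _ _ ψ, ?_⟩
    rw [← adj.homEquiv_naturality_left, hψ, Equiv.apply_symm_apply]
  · intro h φ
    obtain ⟨ψ, hψ⟩ := h (adj.homEquiv _ _ φ)
    refine ⟨(adj.homEquiv _ _).symm ψ, ?_⟩
    rw [← adj.homEquiv_naturality_left_symm, hψ, Equiv.symm_apply_apply]

variable [Abelian A] [R.Faithful]

/-- The triangle identity provides the section, so objects in the image of `L` are acyclic for every
functor. -/
lemma isSplitEpi_proj_obj (d : D) : IsSplitEpi ((counitLeftResolution adj).proj (L.obj d)) :=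
  ⟨⟨L.map (adj.unit.app d), adj.left_triangle_components d⟩⟩

lemma isSplitEpi_proj_F_obj (X : A) :
    IsSplitEpi ((counitLeftResolution adj).proj ((counitLeftResolution adj).F.obj X)) :=
  isSplitEpi_proj_obj adj _

lemma isSplitEpi_proj_of_projective {X : A} (hX : Projective X) :
    IsSplitEpi ((counitLeftResolution adj).proj X) :=
  ⟨⟨Projective.factorThru (𝟙 X) _, Projective.factorThru_comp _ _⟩⟩

include adj in
lemma relProjective_of_projective {X : A} (hX : Projective X) : relProjective L R X :=
  ⟨X, ⟨⟨Projective.factorThru (𝟙 X) (adj.counit.app X), adj.counit.app X,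
    Projective.factorThru_comp _ _⟩⟩⟩

end

namespace NakayamaFunctor

variable {A : Type u} [Category.{v} A] [Abelian A] {B : Type u'} [Category.{v'} B] [Abelian B]
  {fShriek : B ⥤ A} {fUpper : A ⥤ B} {adj : fShriek ⊣ fUpper} (N : NakayamaFunctor adj)

/-- The isomorphism `ν⁻ ∘ ν ∘ f_! ≅ f_!`. -/
noncomputable def isoShriek : (fShriek ⋙ N.nu) ⋙ N.nuMinus ≅ fShriek :=
  NatIso.ofComponents
    (fun d => haveI := N.isIso_unit d; (asIso (N.adjNu.unit.app (fShriek.obj d))).symm)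
    (fun {d d'} f => by
      have := N.isIso_unit d
      have := N.isIso_unit d'
      dsimp
      rw [IsIso.comp_inv_eq, Category.assoc, IsIso.eq_inv_comp]
      exact (N.adjNu.unit.naturality (fShriek.map f)).symm)

/-- The functor `f^* ∘ ν` is left adjoint to `f_!`. -/
noncomputable def adjShriek : N.nu ⋙ fUpper ⊣ fShriek :=
  (N.adjNu.comp N.adjStar).ofNatIsoRight N.isoShriek

include adj in
lemma preservesFiniteLimits_upper : PreservesFiniteLimits fUpper := by
  have := adj.rightAdjoint_preservesLimits
  infer_instance

include N

lemma preservesFiniteColimits_upper : PreservesFiniteColimits fUpper := by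
  have := N.adjStar.leftAdjoint_preservesColimits
  infer_instance

lemma preservesFiniteLimits_shriek : PreservesFiniteLimits fShriek := by
  have := N.adjShriek.rightAdjoint_preservesLimits
  infer_instance

lemma preservesFiniteColimits_shriek : PreservesFiniteColimits fShriek := by
  have := adj.leftAdjoint_preservesColimits
  infer_instance

lemma preservesFiniteColimits_nu : PreservesFiniteColimits N.nu := by
  have := N.adjNu.leftAdjoint_preservesColimits
  infer_instance

lemma preservesFiniteLimits_nuMinus : PreservesFiniteLimits N.nuMinus := by
  have := N.adjNu.rightAdjoint_preservesLimits
  infer_instance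

lemma preservesFiniteLimits_star : PreservesFiniteLimits (fShriek ⋙ N.nu) := by
  have := N.adjStar.rightAdjoint_preservesLimits
  infer_instance

lemma preservesFiniteColimits_star : PreservesFiniteColimits (fShriek ⋙ N.nu) := by
  have := N.preservesFiniteColimits_shriek
  have := N.preservesFiniteColimits_nu
  exact comp_preservesFiniteColimits _ _

lemma upper_additive : fUpper.Additive := by
  have := preservesFiniteLimits_upper (adj := adj)
  exact Functor.additive_of_preserves_binary_products _

lemma shriek_additive : fShriek.Additive := by
  have := N.upper_additive
  exact adj.left_adjoint_additive

variable [fUpper.Faithful]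

lemma adapted : (counitLeftResolution adj).F.Additive ∧
    PreservesFiniteLimits (counitLeftResolution adj).F ∧
    PreservesFiniteColimits (counitLeftResolution adj).F ∧ PreservesFiniteColimits N.nu ∧
    PreservesFiniteLimits ((counitLeftResolution adj).F ⋙ N.nu) := by
  have := N.upper_additive
  have := N.shriek_additive
  have := preservesFiniteLimits_upper (adj := adj)
  have := N.preservesFiniteColimits_upper
  have := N.preservesFiniteLimits_shriek
  have := N.preservesFiniteColimits_shriek
  have := N.preservesFiniteLimits_star
  exact ⟨inferInstanceAs (fUpper ⋙ fShriek).Additive,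
    comp_preservesFiniteLimits fUpper fShriek, comp_preservesFiniteColimits fUpper fShriek,
    N.preservesFiniteColimits_nu, comp_preservesFiniteLimits fUpper (fShriek ⋙ N.nu)⟩

/-- The last condition is right exactness of `ν⁻ f_* f^*` in the opposite category; it holds because
`ν⁻ f_* ≅ f_!`. -/
lemma adapted_op : (counitLeftResolution N.adjStar.op).F.Additive ∧
    PreservesFiniteLimits (counitLeftResolution N.adjStar.op).F ∧
    PreservesFiniteColimits (counitLeftResolution N.adjStar.op).F ∧
    PreservesFiniteColimits N.nuMinus.op ∧
    PreservesFiniteLimits ((counitLeftResolution N.adjStar.op).F ⋙ N.nuMinus.op) := by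
  have := N.upper_additive
  have := N.shriek_additive
  have := preservesFiniteLimits_upper (adj := adj)
  have := N.preservesFiniteColimits_upper
  have := N.preservesFiniteColimits_shriek
  have := N.preservesFiniteLimits_star
  have := N.preservesFiniteColimits_star
  have := N.preservesFiniteLimits_nuMinus
  have h₁ : PreservesFiniteLimits (fUpper ⋙ fShriek ⋙ N.nu) := comp_preservesFiniteLimits _ _
  have h₂ : PreservesFiniteColimits (fUpper ⋙ fShriek ⋙ N.nu) := comp_preservesFiniteColimits _ _
  have h₃ : PreservesFiniteColimits (fUpper ⋙ (fShriek ⋙ N.nu) ⋙ N.nuMinus) := by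
    have := preservesFiniteColimits_of_natIso N.isoShriek.symm
    exact comp_preservesFiniteColimits _ _
  refine ⟨inferInstanceAs (fUpper ⋙ fShriek ⋙ N.nu).op.Additive, ?_, ?_, ?_, ?_⟩
  · exact preservesFiniteLimits_op (fUpper ⋙ fShriek ⋙ N.nu)
  · exact preservesFiniteColimits_op (fUpper ⋙ fShriek ⋙ N.nu)
  · exact preservesFiniteColimits_op N.nuMinus
  · exact preservesFiniteLimits_op (fUpper ⋙ (fShriek ⋙ N.nu) ⋙ N.nuMinus)

/-- The objects at which all higher left derived functors of `ν` vanish. -/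
abbrev IsAcyclic (X : A) : Prop := (counitLeftResolution adj).IsAcyclicFor N.nu X

variable {N}

lemma IsIwanagaGorenstein.firstVanishes (hP : N.IsIwanagaGorenstein) :
    ∃ n, ∀ X i, n ≤ i → (counitLeftResolution adj).FirstVanishes N.nu
      ((counitLeftResolution adj).syz i X) := by
  obtain ⟨n, hn⟩ := hP
  obtain ⟨_, _, _, _, _⟩ := N.adapted
  exact ⟨n, fun X i hi => LeftResolution.firstVanishes_of_isZero_homology _ _ _ _
    ((hn (i + 1) (by lia)).1 X)⟩

lemma IsIwanagaGorenstein.firstVanishes_op (hP : N.IsIwanagaGorenstein) :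
    ∃ n, ∀ X i, n ≤ i → (counitLeftResolution N.adjStar.op).FirstVanishes N.nuMinus.op
      ((counitLeftResolution N.adjStar.op).syz i X) := by
  obtain ⟨n, hn⟩ := hP
  obtain ⟨_, _, _, _, _⟩ := N.adapted_op
  exact ⟨n, fun X i hi => LeftResolution.firstVanishes_of_isZero_homology _ _ _ _
    ((hn (i + 1) (by lia)).2 X.unop).op⟩

lemma IsAcyclic.of_projective {X : A} (hX : Projective X) : N.IsAcyclic X :=
  LeftResolution.isAcyclicFor_of_isSplitEpi (isSplitEpi_proj_F_obj adj)
    (isSplitEpi_proj_of_projective adj hX)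

lemma IsAcyclic.of_relProjective {X : A} (hX : relProjective fShriek fUpper X) :
    N.IsAcyclic X := by
  obtain ⟨Y, ⟨r⟩⟩ := hX
  exact LeftResolution.isAcyclicFor_of_isSplitEpi (isSplitEpi_proj_F_obj adj)
    (LeftResolution.isSplitEpi_of_retract r (isSplitEpi_proj_obj adj _))

lemma IsAcyclic.map_shortExact {S : ShortComplex A} (hS : S.ShortExact) (h : N.IsAcyclic S.X₃) :
    (S.map N.nu).ShortExact := by
  obtain ⟨_, _, _, _, _⟩ := N.adapted
  exact LeftResolution.IsAcyclicFor.map_shortExact hS h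

lemma IsAcyclic.X₁ {S : ShortComplex A} (hS : S.ShortExact) (h₂ : N.IsAcyclic S.X₂)
    (h₃ : N.IsAcyclic S.X₃) : N.IsAcyclic S.X₁ := by
  obtain ⟨_, _, _, _, _⟩ := N.adapted
  exact LeftResolution.isAcyclicFor_X₁ hS h₂ h₃

lemma IsAcyclic.X₃ {S : ShortComplex A} (hS : S.ShortExact) (h₁ : N.IsAcyclic S.X₁)
    (h₂ : N.IsAcyclic S.X₂) [Mono (N.nu.map S.f)] : N.IsAcyclic S.X₃ := by
  obtain ⟨_, _, _, _, _⟩ := N.adapted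
  exact LeftResolution.isAcyclicFor_X₃ hS h₁ h₂

lemma isAcyclic_cycles (hP : N.IsIwanagaGorenstein) {K : ChainComplex A ℤ} (hK : K.Acyclic)
    (h : ∀ i, relProjective fShriek fUpper (K.X i)) (i : ℤ) : N.IsAcyclic (K.cycles i) := by
  obtain ⟨_, _, _, _, _⟩ := N.adapted
  obtain ⟨n, hn⟩ := hP.firstVanishes
  refine LeftResolution.isAcyclicFor_of_int_sequence hn (fun i => K.cycles i) (fun i j hij => ?_) i
  obtain ⟨w, hS⟩ := K.exists_shortExact_cycles hK hij
  exact ⟨_, _, _, w, IsAcyclic.of_relProjective (h i), hS⟩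

lemma isAcyclic_of_gorensteinProjective (hP : N.IsIwanagaGorenstein) {X : A}
    (hX : gorensteinProjective A X) : N.IsAcyclic X := by
  obtain ⟨K, hK, ⟨e⟩⟩ := hX
  exact (isAcyclic_cycles hP hK.acyclic
    (fun i => relProjective_of_projective adj (hK.projective i)) 0).of_iso e

/-- Apply `ν⁻ ν` to `0 ⟶ Ω X ⟶ F X ⟶ X ⟶ 0`. The unit is an isomorphism at `F X`, so by the snake
lemma it is mono at `X` once it is epi at `Ω X`. -/
lemma IsAcyclic.mono_unit (hP : N.IsIwanagaGorenstein) {X : A} (hX : N.IsAcyclic X) :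
    Mono (N.adjNu.unit.app X) := by
  let Λ := counitLeftResolution adj
  have hT (k : ℕ) : IsIso (N.adjNu.unit.app (Λ.F.obj (Λ.syz k X))) := N.isIso_unit _
  have hacyc (k : ℕ) : N.IsAcyclic (Λ.syz k X) := by
    induction k with
    | zero => exact hX
    | succ k ih =>
      exact .X₁ (Λ.syzygySeq_shortExact (Λ.syz k X)) (.of_relProjective ⟨_, ⟨.refl _⟩⟩) ih
  have hnu (k : ℕ) := (hacyc k).map_shortExact (Λ.syzygySeq_shortExact (Λ.syz k X))
  have hepi (k : ℕ) : Epi (N.nuMinus.map (N.nu.map (Λ.proj (Λ.syz k X)))) := by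
    obtain ⟨_, _, _, _, _⟩ := N.adapted_op
    obtain ⟨n, hn⟩ := hP.firstVanishes_op
    -- The images under `ν` of the syzygy sequences resolve each `ν (Ω^k X)` by objects in the image
    -- of `f_*`. In the opposite category this is an infinite coresolution, so the vanishing of `R^i
    -- ν⁻` in high degrees makes each of them ν⁻-acyclic.
    have := LeftResolution.isAcyclicFor_of_coresolution hn (fun k => op (N.nu.obj (Λ.syz k X)))
      (fun k => op (N.nu.obj (Λ.F.obj (Λ.syz k X)))) (fun k => (N.nu.map (Λ.proj (Λ.syz k X))).op)
      (fun k => (N.nu.map (Λ.incl (Λ.syz k X))).op)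
      (fun k => congrArg Quiver.Hom.op ((Λ.syzygySeq (Λ.syz k X)).map N.nu).zero) (fun k => (hnu k).op)
      (fun k => LeftResolution.isAcyclicFor_of_isSplitEpi (isSplitEpi_proj_F_obj _)
        (isSplitEpi_proj_obj N.adjStar.op (op (fUpper.obj (Λ.syz k X)))))
    have hm : Mono (N.nuMinus.op.map (N.nu.map (Λ.proj (Λ.syz k X))).op) :=
      LeftResolution.IsAcyclicFor.mono_map (hnu k).op (this (k + 1))
    exact (op_mono_iff _).1 hm
  have hunit (k : ℕ) : Epi (N.adjNu.unit.app (Λ.syz k X)) := by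
    have : Epi (Λ.proj (Λ.syz k X) ≫ N.adjNu.unit.app (Λ.syz k X)) := by
      have := N.adjNu.unit.naturality (Λ.proj (Λ.syz k X))
      dsimp at this
      rw [this]
      exact epi_comp _ _
    exact epi_of_epi (Λ.proj (Λ.syz k X)) _
  have hex : (((Λ.syzygySeq X).map N.nu).map N.nuMinus).Exact := by
    have := N.preservesFiniteLimits_nuMinus
    exact ((Functor.preservesFiniteLimits_iff_forall_exact_map_and_mono N.nuMinus).1 inferInstance
      _ (hnu 0)).1
  refine Preadditive.mono_of_cancel_zero _ fun {W} x hx => ?_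
  obtain ⟨W1, p1, _, t, ht⟩ := surjective_up_to_refinements_of_epi (Λ.proj X) x
  have e₁ : (t ≫ N.adjNu.unit.app (Λ.F.obj X)) ≫ N.nuMinus.map (N.nu.map (Λ.proj X)) = 0 := by
    have := N.adjNu.unit.naturality (Λ.proj X)
    dsimp at this
    rw [Category.assoc, ← this, ← reassoc_of% ht, hx, comp_zero]
  obtain ⟨W2, p2, _, y, hy⟩ := ShortComplex.Exact.exists_lift_up_to_refinements
    (f := N.nuMinus.map (N.nu.map (Λ.incl X))) hex _ e₁
  have : Epi (N.adjNu.unit.app (Λ.syzygy.obj X)) := hunit 1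
  obtain ⟨W3, p3, _, z, hz⟩ :=
    surjective_up_to_refinements_of_epi (N.adjNu.unit.app (Λ.syzygy.obj X)) y
  have : IsIso (N.adjNu.unit.app (Λ.F.obj X)) := hT 0
  have e₂ : p3 ≫ p2 ≫ t = z ≫ Λ.incl X := by
    have := N.adjNu.unit.naturality (Λ.incl X)
    dsimp at this
    rw [← cancel_mono (N.adjNu.unit.app (Λ.F.obj X)), Category.assoc, Category.assoc, hy,
      reassoc_of% hz, Category.assoc, this]
  have : Epi (p3 ≫ p2 ≫ p1) := inferInstance
  rw [← cancel_epi (p3 ≫ p2 ≫ p1), Category.assoc, Category.assoc, ht, reassoc_of% e₂]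
  exact (congrArg (z ≫ ·) (Λ.incl_comp_proj X)).trans (comp_zero.trans comp_zero.symm)

/-! ### Transfer of Gorenstein projectivity along `f^* ν ⊣ f_!` -/

variable (N) [EnoughProjectives B]

include adj in
omit N in
lemma exists_epi_shriek_obj (X : A) :
    ∃ (Q : B) (_ : Projective Q) (p : fShriek.obj Q ⟶ X), Epi p := by
  have := adj.leftAdjoint_preservesColimits
  exact ⟨Projective.over (fUpper.obj X), inferInstance,
    fShriek.map (Projective.π (fUpper.obj X)) ≫ adj.counit.app X, inferInstance⟩

lemma projective_shriek_obj {Q : B} (hQ : Projective Q) : Projective (fShriek.obj Q) := by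
  have := N.preservesFiniteColimits_upper
  exact adj.map_projective Q hQ

lemma projective_upper_nu_obj {Q : A} (hQ : Projective Q) :
    Projective (fUpper.obj (N.nu.obj Q)) := by
  have := N.preservesFiniteColimits_shriek
  exact N.adjShriek.map_projective Q hQ

lemma enoughProjectives : EnoughProjectives A where
  presentation X := by
    obtain ⟨Q, hQ, p, hp⟩ := exists_epi_shriek_obj (adj := adj) X
    exact ⟨{ p := _, projective := N.projective_shriek_obj hQ, f := p, epi := hp }⟩

variable {N}

lemma IsAcyclic.map_upper_shortExact {S : ShortComplex A} (hS : S.ShortExact)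
    (h : N.IsAcyclic S.X₃) :
    ∃ w : fUpper.map (N.nu.map S.f) ≫ fUpper.map (N.nu.map S.g) = 0,
      (ShortComplex.mk _ _ w).ShortExact := by
  have := N.upper_additive
  have := preservesFiniteLimits_upper (adj := adj)
  have := N.preservesFiniteColimits_upper
  exact ⟨_, (h.map_shortExact hS).map_of_exact fUpper⟩

/-- Extending a map from `f^* ν X'` to a projective `Q` amounts to extending a map from `X'` to `f_!
Q`, which is again projective. -/
lemma extVanishes_upper_nu (hP : N.IsIwanagaGorenstein) {X : A} (hX : gorensteinProjective A X) :
    ExtVanishes (fUpper.obj (N.nu.obj X)) := by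
  intro P hQ n
  refine extVanishes_of_class
    (C := fun Y => ∃ X, gorensteinProjective A X ∧ fUpper.obj (N.nu.obj X) = Y) P ?_ n _ ⟨X, hX, rfl⟩
  rintro _ ⟨X, hX, rfl⟩
  obtain ⟨X', hX', Q, f, g, w, hQ, hS⟩ := hX.exists_syzygy
  obtain ⟨w', h⟩ := (isAcyclic_of_gorensteinProjective hP hX).map_upper_shortExact hS
  exact ⟨_, _, _, _, w', ⟨X', hX', rfl⟩, N.projective_upper_nu_obj hQ, h,
    (exists_extension_iff N.adjShriek f P).2
      (hX.extVanishes.exists_extension hS (N.projective_shriek_obj ‹_›))⟩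

lemma gorensteinProjective_upper_nu (hP : N.IsIwanagaGorenstein) {X : A}
    (hX : gorensteinProjective A X) : gorensteinProjective B (fUpper.obj (N.nu.obj X)) := by
  refine gorensteinProjective_of_class
    (C := fun Y => ∃ X, gorensteinProjective A X ∧ fUpper.obj (N.nu.obj X) = Y) ?_ ?_ ⟨X, hX, rfl⟩
  · rintro _ ⟨X, hX, rfl⟩
    exact extVanishes_upper_nu hP hX
  · rintro _ ⟨X, hX, rfl⟩
    obtain ⟨Y, hY, Q, f, g, w, hQ, hS⟩ := hX.exists_cosyzygy
    obtain ⟨w', h⟩ := (isAcyclic_of_gorensteinProjective hP hY).map_upper_shortExact hS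
    exact ⟨_, ⟨Y, hY, rfl⟩, _, _, _, w', N.projective_upper_nu_obj hQ, h⟩

lemma relGorensteinProjective_of_gorensteinProjective (hP : N.IsIwanagaGorenstein) {X : A}
    (hX : gorensteinProjective A X) : N.relGorensteinProjective X := by
  obtain ⟨K, hK, he⟩ := hX
  have hK' (i : ℤ) := relProjective_of_projective adj (hK.projective i)
  obtain ⟨_, _, _, _, _⟩ := N.adapted
  exact ⟨K, hK', hK.acyclic, LeftResolution.acyclic_map_of_isAcyclicFor_cycles
    (Λ := counitLeftResolution adj) hK.acyclic (isAcyclic_cycles hP hK.acyclic hK'), he⟩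

/-- The unit is `X ⟶ ν⁻ ν X ⟶ ν⁻ f_* f^* ν X ≅ f_! f^* ν X`. The second map is mono because `f^*` is
faithful and `ν⁻` is left exact. -/
lemma IsAcyclic.mono_unit_adjShriek (hP : N.IsIwanagaGorenstein) {X : A} (hX : N.IsAcyclic X) :
    Mono (N.adjShriek.unit.app X) := by
  have := hX.mono_unit hP
  have := N.preservesFiniteLimits_nuMinus
  have h : N.adjShriek.unit.app X = (N.adjNu.unit.app X ≫
      N.nuMinus.map (N.adjStar.unit.app (N.nu.obj X))) ≫ N.isoShriek.hom.app _ := by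
    simp [adjShriek, Adjunction.comp_unit_app]
  rw [h]
  infer_instance

lemma extVanishes_of_isAcyclic {X : A} (hX : N.IsAcyclic X)
    (hX' : gorensteinProjective B (fUpper.obj (N.nu.obj X))) : ExtVanishes X := by
  have := N.enoughProjectives
  intro P hP n
  refine extVanishes_of_class (C := fun X => N.IsAcyclic X ∧
    gorensteinProjective B (fUpper.obj (N.nu.obj X))) P ?_ n _ ⟨hX, hX'⟩
  rintro X ⟨hX, hX'⟩
  let S := ShortComplex.mk (kernel.ι (Projective.π X)) (Projective.π X) (kernel.condition _)
  have hS : S.ShortExact := .mk' (ShortComplex.exact_kernel _) inferInstance inferInstance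
  have hQ : Projective S.X₂ := inferInstanceAs (Projective (Projective.over X))
  obtain ⟨w', h⟩ := hX.map_upper_shortExact hS
  refine ⟨S.X₁, S.X₂, S.f, S.g, S.zero, ⟨.X₁ hS (.of_projective hQ) hX,
    gorensteinProjective_X₁ h (N.projective_upper_nu_obj hQ) hX'⟩, hQ, hS, fun φ => ?_⟩
  -- `P` is a summand of `f_! Q`. The map is extended after passing to `f_! Q`, where the adjunction
  -- applies, and then projected back to `P`.
  obtain ⟨Q, hQ, p, hp⟩ := exists_epi_shriek_obj (adj := adj) P
  obtain ⟨ψ, hψ⟩ := (exists_extension_iff N.adjShriek S.f Q).1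
    (hX'.extVanishes.exists_extension h hQ) (φ ≫ Projective.factorThru (𝟙 P) p)
  exact ⟨ψ ≫ p, by simp [reassoc_of% hψ]⟩

lemma exists_cosyzygy_of_isAcyclic (hP : N.IsIwanagaGorenstein) {X : A} (hX : N.IsAcyclic X)
    (hX' : gorensteinProjective B (fUpper.obj (N.nu.obj X))) :
    ∃ Y, (N.IsAcyclic Y ∧ gorensteinProjective B (fUpper.obj (N.nu.obj Y))) ∧ IsSyzygyOf X Y := by
  obtain ⟨G, hG, Q, f, g, w, hQ, hT⟩ := hX'.exists_cosyzygy
  have : Mono f := hT.mono_f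
  have := hX.mono_unit_adjShriek hP
  have := N.preservesFiniteLimits_shriek
  let m : X ⟶ fShriek.obj Q := N.adjShriek.unit.app X ≫ fShriek.map f
  have hm : (N.nu ⋙ fUpper).map m ≫ N.adjShriek.counit.app Q = f := by
    have := N.adjShriek.homEquiv_counit (g := m)
    rw [← this, Equiv.symm_apply_eq, N.adjShriek.homEquiv_unit]
  -- `f^* ν m` is mono as the first factor of `f`, and the faithful functor `f^*` reflects monos.
  have hmono : Mono (N.nu.map m) := by
    have : Mono ((N.nu ⋙ fUpper).map m) := by
      apply mono_of_mono_fac hm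
    have : Mono (fUpper.map (N.nu.map m)) := this
    exact fUpper.mono_of_mono_map this
  have hQ' := N.projective_shriek_obj hQ
  let S := ShortComplex.mk m (cokernel.π m) (cokernel.condition m)
  have hS : S.ShortExact := .mk' (ShortComplex.exact_cokernel _) inferInstance inferInstance
  have hmS : Mono (N.nu.map S.f) := hmono
  have hY : N.IsAcyclic S.X₃ := .X₃ hS hX (.of_projective hQ')
  obtain ⟨w', h⟩ := hY.map_upper_shortExact hS
  -- The cokernel of `f^* ν m` need not be `G`. However, maps to projectives extend along `f`, and
  -- `f` factors through `f^* ν m` by the counit, so they extend along `f^* ν m`.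
  refine ⟨S.X₃, ⟨hY, gorensteinProjective_X₃ h
    (N.projective_upper_nu_obj hQ') hX' fun P hP φ => ?_⟩, _, _, _, S.zero, hQ', hS⟩
  obtain ⟨ψ, hψ⟩ := hG.extVanishes.exists_extension hT hP φ
  refine ⟨N.adjShriek.counit.app Q ≫ ψ, ?_⟩
  change (N.nu ⋙ fUpper).map m ≫ N.adjShriek.counit.app Q ≫ ψ = φ
  rw [← Category.assoc, hm]
  exact hψ

theorem liftedGorensteinProjective_iff (hP : N.IsIwanagaGorenstein) (X : A) :
    N.liftedGorensteinProjective X ↔ gorensteinProjective A X := by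
  have := N.enoughProjectives
  constructor
  · rintro ⟨hX, K, hK, hK', -, ⟨e⟩⟩
    exact gorensteinProjective_of_class
      (C := fun X => N.IsAcyclic X ∧ gorensteinProjective B (fUpper.obj (N.nu.obj X)))
      (fun X hX => extVanishes_of_isAcyclic hX.1 hX.2)
      (fun X hX => exists_cosyzygy_of_isAcyclic hP hX.1 hX.2)
      ⟨(isAcyclic_cycles hP hK' hK 0).of_iso e, hX⟩
  · intro hX
    exact ⟨gorensteinProjective_upper_nu hP hX,
      relGorensteinProjective_of_gorensteinProjective hP hX⟩

end NakayamaFunctor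

end GorensteinLift

theorem mainTheorem3 {A : Type u} [CategoryTheory.Category.{v} A] [CategoryTheory.Abelian A]
    {B : Type u'} [CategoryTheory.Category.{v'} B] [CategoryTheory.Abelian B]
    [CategoryTheory.EnoughProjectives B]
    (fShriek : B ⥤ A) (fUpper : A ⥤ B) [fUpper.Faithful]
    (adj : fShriek ⊣ fUpper)
    (N : GorensteinLift.NakayamaFunctor adj)
    (hP : N.IsIwanagaGorenstein) :
    N.liftedGorensteinProjective = GorensteinLift.gorensteinProjective A := by
  ext X
  exact GorensteinLift.NakayamaFunctor.liftedGorensteinProjective_iff hP X
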